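/- Let $S$ be a countable set and let $(X_t)_{t\ge 0}$ be a time-homogeneous continuous-time Markov process on $S$ with right-continuous paths (for the discrete topology) and transition rates $a(j,k)\ge 0$, $\sum_k a(j,k)<\infty$ for every $j$; neither symmetry nor any structure of $S$ is assumed. Write $p_t(j,k)=\mathbb P[X_t=k\mid X_0=j]$. Fix $i\in S$, start the process in $i$, let $L_t=\int_0^t \mathbf 1_{\{X_s=i\}}\,ds$ be its local time in $i$, and put $$G_\infty=\int_0^\infty p_t(i,i)\,dt\in(0,\infty],\qquad H_\infty=\int_0^\infty t\,p_t(i,i)\,dt,\qquad \kappa_{cr}=\frac1{G_\infty}\quad(\tfrac1\infty:=0).$$ Then for every $\kappa>0$ the limit $r(\kappa)=\lim_{t\to\infty}\frac1t\log\mathbb E[e^{\kappa L_t}]$ exists in $\mathbb R$, and: (i) for every $\kappa>0$: $r(\kappa)\ge 0$, and $r(\kappa)>0$ if and only if $\kappa>\kappa_{cr}$; (iii) $r(\kappa)\le\kappa$ for every $\kappa>0$, and $r(\kappa)/\kappa\to1$ as $\kappa\to\infty$. If moreover $p_t(i,i)\sim c\,t^{-\alpha}$ as $t\to\infty$ for some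 constants $c>0$, $\alpha>0$ (where $h_1\sim h_2$ means $h_1/h_2\to1$), then also: (ii) $r$ is strictly convex on $(\kappa_{cr},\infty)$; (iv) if $\alpha\le1$, then $\kappa_{cr}=0$ and, as $\kappa\downarrow0$, $$r(\kappa)\sim\begin{cases}\kappa^{\frac1{1-\alpha}}\,(c\,\Gamma(1-\alpha))^{\frac1{1-\alpha}}, & 0<\alpha<1,\\ \exp\bigl(-(c\kappa)^{-1}+o(\kappa^{-1})\bigr), & \alpha=1;\end{cases}$$ (v) if $\alpha>1$, then $G_\infty<\infty$, $\kappa_{cr}>0$ and, as $\kappa\downarrow\kappa_{cr}$, $$r(\kappa)\sim\begin{cases}(\kappa-\kappa_{cr})^{\frac1{\alpha-1}}\left(\dfrac{G_\infty^2(\alpha-1)}{c\,\Gamma(2-\alpha)}\right)^{\frac1{\alpha-1}}, & 1<\alpha<2,\\[2mm] \dfrac{\kappa-\kappa_{cr}}{\log\bigl(1/(\kappa-\kappa_{cr})\bigr)}\,\dfrac{G_\infty^2}{c}, & \alpha=2,\\[2mm] (\kappa-\kappa_{cr})\,\dfrac{G_\infty^2}{H_\infty}\quad\text{with } H_\infty<\infty,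 & \alpha>2.\end{cases}$$ -/

import Mathlib

open MeasureTheory Filter Topology Asymptotics
open scoped NNReal ENNReal

namespace LocalTimeRate

noncomputable section

variable {S Ω : Type*} [MeasurableSpace Ω]

/-- The transition probability `p_t(j,k) = P^j[X_t = k]`, where `P j` is the law under which the
process `X` is started in `j`. -/
def transProb (P : S → Measure Ω) (X : ℝ≥0 → Ω → S) (t : ℝ≥0) (j k : S) : ℝ :=
  (P j).real {ω | X t ω = k}

/-- `X` is, under the family of laws `P`, a time-homogeneous continuous-time Markov process
(with right-continuous paths in the discrete space `S`) with transition rates `a`. The diagonal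
entries `a j j` are irrelevant. -/
structure IsMarkovProcess [MeasurableSpace S] (a : S → S → ℝ) (P : S → Measure Ω)
    (X : ℝ≥0 → Ω → S) : Prop where
  rate_nonneg : ∀ j k, 0 ≤ a j k
  rate_summable : ∀ j, Summable (a j)
  isProbabilityMeasure : ∀ j, IsProbabilityMeasure (P j)
  measurable : ∀ t, Measurable (X t)
  right_continuous : ∀ ω t, ∀ᶠ s in 𝓝[≥] t, X s ω = X t ω
  start : ∀ j, ∀ᵐ ω ∂(P j), X 0 ω = j
  /-- The Markov property with respect to the natural filtration. -/
  markov : ∀ (s t : ℝ≥0) (A : Set Ω),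
    MeasurableSet[⨆ u : Set.Iic s, MeasurableSpace.comap (X u) inferInstance] A →
    ∀ j k l, P j (A ∩ {ω | X s ω = k} ∩ {ω | X (s + t) ω = l}) =
      P j (A ∩ {ω | X s ω = k}) * P k {ω | X t ω = l}
  /-- The rate of jumping from `j` to `k` is `a j k`. -/
  rate_offDiag : ∀ j k, j ≠ k →
    Tendsto (fun t : ℝ≥0 => transProb P X t j k / t) (𝓝[>] 0) (𝓝 (a j k))
  /-- The total rate of leaving `j` is the sum of the rates `a j k`, `k ≠ j`. -/
  rate_diag : ∀ j,
    Tendsto (fun t : ℝ≥0 => (1 - transProb P X t j j) / t) (𝓝[>] 0)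
      (𝓝 (∑' k : {k : S // k ≠ j}, a j k))

/-- The local time `L_t = ∫_0^t δ_i(X_s) ds` in `i`. -/
def localTime (X : ℝ≥0 → Ω → S) (i : S) (t : ℝ≥0) (ω : Ω) : ℝ :=
  ∫ s in (0 : ℝ)..t, Set.indicator {i} (fun _ => (1 : ℝ)) (X s.toNNReal ω)

/-- `E[exp (κ L_t)]` for the local time in `i` of the process started in `i`. -/
def expMoment (P : S → Measure Ω) (X : ℝ≥0 → Ω → S) (i : S) (κ : ℝ) (t : ℝ≥0) : ℝ :=
  ∫ ω, Real.exp (κ * localTime X i t ω) ∂(P i)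

/-- `G_∞ = ∫_0^∞ p_t(i,i) dt ∈ [0,∞]`. -/
def green (P : S → Measure Ω) (X : ℝ≥0 → Ω → S) (i : S) : ℝ≥0∞ :=
  ∫⁻ t in Set.Ioi (0 : ℝ), ENNReal.ofReal (transProb P X t.toNNReal i i)

/-- `H_∞ = ∫_0^∞ t p_t(i,i) dt ∈ [0,∞]`. -/
def greenMoment (P : S → Measure Ω) (X : ℝ≥0 → Ω → S) (i : S) : ℝ≥0∞ :=
  ∫⁻ t in Set.Ioi (0 : ℝ), ENNReal.ofReal (t * transProb P X t.toNNReal i i)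

/-- `κ_cr = 1 / G_∞`, with `1 / ∞ = 0`. -/
def kappaCr (P : S → Measure Ω) (X : ℝ≥0 → Ω → S) (i : S) : ℝ :=
  ((green P X i)⁻¹).toReal

end

end LocalTimeRate

/-!
Let `p t` be the probability that the process started in `i` is in `i` at time `t`. Expanding
`exp (κ L_t)` along the visits to `i`, and using that the process regenerates at each of them, gives
for `v t = E[exp (κ L_t); X_t = i]` and `m t = E[exp (κ L_t)]` the equations
`v = p + κ v ⋆ p` and `m = 1 + κ v ⋆ 1`. Hence `κ v` is the resolvent of the kernel `κ p`, and `m`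
solves the renewal equation `m = 1 + κ p ⋆ m`. Multiplying by `exp (-l t)` turns the kernel into one
of mass `κ * laplace p l`; if this is less than one, the tilted solution is bounded, and if it is
greater than one, the tilted solution stays away from zero. The exponential growth rate of `m` is
therefore the root `l` of `κ * laplace p l = 1`, or zero if `κ * ∫ p ≤ 1`.

All remaining claims are about this root. Near the critical value they follow from Abelian theorems
for `laplace p` and, for `α > 1`, for its derivative. Convexity of the rate in `κ` is inherited
from the cumulant generating functions of `L_t`. If it were not strict, the rate would be affine on
an interval, so `laplace p l * (l - B) = A` on an interval and by analyticity for all `l > 0`, which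
a power-like tail of `p` excludes.
-/

namespace LocalTimeRate

noncomputable section

open Set

section Laplace

variable {f : ℝ → ℝ} {C c l α : ℝ}

/-- The Laplace transform `l ↦ ∫_0^∞ e^{-lt} f(t) dt`. -/
def laplace (f : ℝ → ℝ) (l : ℝ) : ℝ :=
  ∫ t in Ioi (0 : ℝ), Real.exp (-(l * t)) * f t

/-- The Laplace integral of `f` converges absolutely on the open half-line `(0, ∞)`. -/
def LaplaceIntegrable (f : ℝ → ℝ) : Prop :=
  ∀ l, 0 < l → IntegrableOn (fun t => Real.exp (-(l * t)) * f t) (Ioi 0)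

theorem laplaceIntegrable_of_abs_le (hf : Measurable f) (hC : ∀ t, |f t| ≤ C) :
    LaplaceIntegrable f := fun l hl => by
  have hexp : IntegrableOn (fun t => Real.exp (-(l * t))) (Ioi 0) := by
    simpa only [neg_mul] using exp_neg_integrableOn_Ioi 0 hl
  exact hexp.mul_bdd (c := C) hf.aestronglyMeasurable (ae_of_all _ hC)

theorem mul_exp_neg_le (hl : 0 < l) (t : ℝ) :
    t * Real.exp (-(l * t)) ≤ 2 / l * Real.exp (-(l / 2 * t)) := by
  have hsplit : Real.exp (-(l * t)) = Real.exp (-(l / 2 * t)) * Real.exp (-(l / 2 * t)) := by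
    rw [← Real.exp_add]; ring_nf
  have hlin : l / 2 * t * Real.exp (-(l / 2 * t)) ≤ 1 := by
    rw [Real.exp_neg, mul_inv_le_iff₀ (Real.exp_pos _), one_mul]
    linarith [Real.add_one_le_exp (l / 2 * t)]
  calc t * Real.exp (-(l * t))
      = 2 / l * (l / 2 * t * Real.exp (-(l / 2 * t))) * Real.exp (-(l / 2 * t)) := by
        rw [hsplit]; field_simp
    _ ≤ 2 / l * 1 * Real.exp (-(l / 2 * t)) := by gcongr
    _ = 2 / l * Real.exp (-(l / 2 * t)) := by ring

theorem LaplaceIntegrable.id_mul (hf : LaplaceIntegrable f) :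
    LaplaceIntegrable fun t => t * f t := fun l hl => by
  have hmeas : AEStronglyMeasurable (fun t => t * (Real.exp (-(l * t)) * f t))
      (volume.restrict (Ioi 0)) :=
    measurable_id.aestronglyMeasurable.mul (hf l hl).aestronglyMeasurable
  refine (((hf (l / 2) (half_pos hl)).norm.const_mul (2 / l)).mono' hmeas ?_).congr
    (ae_of_all _ fun t => by ring)
  filter_upwards [ae_restrict_mem measurableSet_Ioi] with t ht
  have htpos : (0 : ℝ) < t := ht
  simp only [norm_mul, Real.norm_eq_abs, Real.abs_exp, abs_of_pos htpos, ← mul_assoc]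
  exact mul_le_mul_of_nonneg_right (mul_exp_neg_le hl t) (abs_nonneg _)

theorem LaplaceIntegrable.pow_mul (hf : LaplaceIntegrable f) :
    ∀ n : ℕ, LaplaceIntegrable fun t => t ^ n * f t
  | 0 => by simpa only [pow_zero, one_mul] using hf
  | n + 1 => by simpa only [pow_succ', mul_assoc] using (hf.pow_mul n).id_mul

theorem LaplaceIntegrable.hasDerivAt_laplace (hf : LaplaceIntegrable f) (hl : 0 < l) :
    HasDerivAt (laplace f) (-laplace (fun t => t * f t) l) l := by
  have hderiv : ∀ x t : ℝ, HasDerivAt (fun x => Real.exp (-(x * t)) * f t)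
      (-(Real.exp (-(x * t)) * (t * f t))) x := fun x t => by
    convert! (hasDerivAt_mul_const t).fun_neg.exp.mul_const (f t) using 1
    ring
  have hbound : ∀ᵐ t ∂volume.restrict (Ioi 0), ∀ x ∈ Ioi (l / 2),
      ‖-(Real.exp (-(x * t)) * (t * f t))‖ ≤ ‖Real.exp (-(l / 2 * t)) * (t * f t)‖ := by
    filter_upwards [ae_restrict_mem measurableSet_Ioi] with t (ht : 0 < t) x (hx : l / 2 < x)
    simp only [norm_neg, norm_mul, Real.norm_eq_abs, Real.abs_exp]
    gcongr
  have key := (hasDerivAt_integral_of_dominated_loc_of_deriv_le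
    (Ioi_mem_nhds (half_lt_self hl)) (eventually_of_mem (Ioi_mem_nhds hl)
      fun x hx => (hf x hx).aestronglyMeasurable)
    (hf l hl) (hf.id_mul l hl).aestronglyMeasurable.neg hbound
    (hf.id_mul _ (half_pos hl)).norm (ae_of_all _ fun t x _ => hderiv x t)).2
  rwa [integral_neg] at key

theorem LaplaceIntegrable.hasDerivAt_laplace_pow_mul (hf : LaplaceIntegrable f) (n : ℕ)
    (hl : 0 < l) :
    HasDerivAt (laplace fun t => t ^ n * f t) (-laplace (fun t => t ^ (n + 1) * f t) l) l := by
  simpa only [pow_succ', mul_assoc] using (hf.pow_mul n).hasDerivAt_laplace hl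

theorem LaplaceIntegrable.continuousOn_laplace (hf : LaplaceIntegrable f) :
    ContinuousOn (laplace f) (Ioi 0) :=
  fun _ hl => (hf.hasDerivAt_laplace hl).continuousAt.continuousWithinAt

theorem LaplaceIntegrable.analyticOnNhd_laplace (hf : LaplaceIntegrable f) (hmeas : Measurable f)
    (hf₀ : 0 ≤ f) : AnalyticOnNhd ℝ (laplace f) (Ioi 0) := fun l hl => by
  let μ := (volume.restrict (Ioi 0)).withDensity fun t => ENNReal.ofReal (f t)
  have hmgf : laplace f = ProbabilityTheory.mgf (fun t => -t) μ := by
    ext x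
    rw [ProbabilityTheory.mgf, integral_withDensity_eq_integral_toReal_smul
      hmeas.ennreal_ofReal (ae_of_all _ fun _ => ENNReal.ofReal_lt_top)]
    refine integral_congr_ae (ae_of_all _ fun t => ?_)
    simp only [ENNReal.toReal_ofReal (hf₀ t), smul_eq_mul, mul_neg, mul_comm]
  have hsub : Ioi 0 ⊆ ProbabilityTheory.integrableExpSet (fun t => -t) μ := fun x hx => by
    rw [ProbabilityTheory.integrableExpSet, mem_ofPred_eq,
      integrable_withDensity_iff_integrable_smul' hmeas.ennreal_ofReal
        (ae_of_all _ fun _ => ENNReal.ofReal_lt_top)]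
    refine (hf x hx).congr (ae_of_all _ fun t => ?_)
    simp only [ENNReal.toReal_ofReal (hf₀ t), smul_eq_mul, mul_neg, mul_comm]
  rw [hmgf]
  exact ProbabilityTheory.analyticAt_mgf (interior_maximal hsub isOpen_Ioi hl)

theorem mul_laplace_eq_integral_comp_div (f : ℝ → ℝ) (hl : 0 < l) :
    l * laplace f l = ∫ s in Ioi (0 : ℝ), Real.exp (-s) * f (s / l) := by
  have h := integral_comp_mul_left_Ioi (fun s => Real.exp (-s) * f (s / l)) 0 hl
  simp only [mul_div_cancel_left₀ _ hl.ne', mul_zero, smul_eq_mul] at h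
  rw [laplace, h, mul_inv_cancel_left₀ hl.ne']

theorem tendsto_laplace_nhdsGT_zero (hf : IntegrableOn f (Ioi 0)) :
    Tendsto (laplace f) (𝓝[>] 0) (𝓝 (∫ t in Ioi (0 : ℝ), f t)) := by
  refine tendsto_integral_filter_of_dominated_convergence (fun t => ‖f t‖)
    (.of_forall fun l => .mul (by fun_prop) hf.aestronglyMeasurable) ?_ hf.norm
    (ae_of_all _ fun t => ?_)
  · filter_upwards [self_mem_nhdsWithin] with l (hl : 0 < l)
    filter_upwards [ae_restrict_mem measurableSet_Ioi] with t (ht : 0 < t)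
    rw [norm_mul, Real.norm_eq_abs, Real.abs_exp]
    exact mul_le_of_le_one_left (norm_nonneg _) (Real.exp_le_one_iff.2 (by nlinarith))
  · have hcont : Continuous fun l : ℝ => Real.exp (-(l * t)) * f t := by fun_prop
    simpa using (hcont.tendsto 0).mono_left nhdsWithin_le_nhds

theorem tendsto_mul_laplace_atTop (hf : Measurable f) (hC : ∀ t, |f t| ≤ C)
    (hlim : Tendsto f (𝓝[>] 0) (𝓝 c)) : Tendsto (fun l => l * laplace f l) atTop (𝓝 c) := by
  have hexp : IntegrableOn (fun s => Real.exp (-s)) (Ioi 0) := integrableOn_exp_neg_Ioi 0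
  suffices h : Tendsto (fun l => ∫ s in Ioi (0 : ℝ), Real.exp (-s) * f (s / l)) atTop
      (𝓝 (∫ s in Ioi (0 : ℝ), Real.exp (-s) * c)) by
    rw [integral_mul_const, integral_exp_neg_Ioi_zero, one_mul] at h
    exact h.congr' ((eventually_gt_atTop 0).mono fun l hl =>
      (mul_laplace_eq_integral_comp_div f hl).symm)
  refine tendsto_integral_filter_of_dominated_convergence (fun s => Real.exp (-s) * C)
    (.of_forall fun l => by fun_prop) (.of_forall fun l => ae_of_all _ fun s => ?_)
    (hexp.mul_const C) ?_
  · rw [norm_mul, Real.norm_eq_abs, Real.abs_exp]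
    exact mul_le_mul_of_nonneg_left (hC _) (Real.exp_nonneg _)
  · filter_upwards [ae_restrict_mem measurableSet_Ioi] with s (hs : 0 < s)
    have hdiv : Tendsto (fun l => s / l) atTop (𝓝[>] 0) := tendsto_nhdsWithin_iff.2
      ⟨tendsto_const_nhds.div_atTop tendsto_id,
        (eventually_gt_atTop 0).mono fun l hl => div_pos hs hl⟩
    exact (hlim.comp hdiv).const_mul _

theorem tendsto_rpow_mul_laplace (hf : Measurable f) (hα : α < 1)
    (hC : ∀ t, 0 < t → |f t * t ^ α| ≤ C)
    (hlim : Tendsto (fun t => f t * t ^ α) atTop (𝓝 c)) :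
    Tendsto (fun l => l ^ (1 - α) * laplace f l) (𝓝[>] 0) (𝓝 (c * Real.Gamma (1 - α))) := by
  have hΓ : IntegrableOn (fun s => Real.exp (-s) * s ^ (1 - α - 1)) (Ioi 0) :=
    Real.GammaIntegral_convergent (sub_pos.2 hα)
  have hscale : ∀ l : ℝ, 0 < l → l ^ (1 - α) * laplace f l =
      ∫ s in Ioi (0 : ℝ), Real.exp (-s) * s ^ (1 - α - 1) * (f (s / l) * (s / l) ^ α) := by
    intro l hl
    rw [sub_eq_neg_add, Real.rpow_add_one hl.ne', mul_assoc,
      mul_laplace_eq_integral_comp_div f hl, ← integral_const_mul]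
    refine setIntegral_congr_fun measurableSet_Ioi fun s (hs : 0 < s) => ?_
    simp only [add_sub_cancel_right, Real.div_rpow hs.le hl.le, Real.rpow_neg hl.le,
      Real.rpow_neg hs.le]
    have := (Real.rpow_pos_of_pos hs α).ne'
    field_simp
  rw [Real.Gamma_eq_integral (sub_pos.2 hα), mul_comm c, ← integral_mul_const]
  refine Tendsto.congr' (eventually_nhdsWithin_of_forall fun l hl => (hscale l hl).symm) ?_
  refine tendsto_integral_filter_of_dominated_convergence
    (fun s => Real.exp (-s) * s ^ (1 - α - 1) * C)
    (.of_forall fun l => by fun_prop) ?_ (hΓ.mul_const C) ?_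
  · filter_upwards [self_mem_nhdsWithin] with l (hl : 0 < l)
    filter_upwards [ae_restrict_mem measurableSet_Ioi] with s (hs : 0 < s)
    rw [norm_mul, Real.norm_of_nonneg (by positivity)]
    exact mul_le_mul_of_nonneg_left (hC _ (div_pos hs hl)) (by positivity)
  · filter_upwards [ae_restrict_mem measurableSet_Ioi] with s (hs : 0 < s)
    exact (hlim.comp (tendsto_inv_nhdsGT_zero.const_mul_atTop hs)).const_mul _

end Laplace

theorem isLittleO_id_of_tendsto_deriv_zero {g g' : ℝ → ℝ} (hg : ∀ x, HasDerivAt g (g' x) x)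
    (hlim : Tendsto g' atTop (𝓝 0)) : g =o[atTop] id := by
  refine isLittleO_iff.2 fun ε hε => ?_
  obtain ⟨X, hX⟩ := eventually_atTop.1 (hlim.norm.eventually
    (ge_mem_nhds (norm_zero.trans_lt (half_pos hε))))
  filter_upwards [eventually_ge_atTop (max X 0),
    (tendsto_id.const_mul_atTop (half_pos hε)).eventually_ge_atTop (‖g X‖ - ε / 2 * X)]
    with x hx hlarge
  have hincr : ‖g x - g X‖ ≤ ε / 2 * ‖x - X‖ :=
    (convex_Ici X).norm_image_sub_le_of_norm_hasDerivWithin_le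
      (fun y _ => (hg y).hasDerivWithinAt) (fun y hy => hX y hy) self_mem_Ici
      (le_of_max_le_left hx)
  rw [Real.norm_of_nonneg (sub_nonneg.2 (le_of_max_le_left hx))] at hincr
  rw [id, Real.norm_of_nonneg (le_of_max_le_right hx)]
  rw [id] at hlarge
  linarith [norm_le_norm_add_norm_sub' (g x) (g X)]

theorem tendsto_div_id_of_tendsto_deriv {g g' : ℝ → ℝ} {c : ℝ} (hg : ∀ x, HasDerivAt g (g' x) x)
    (hlim : Tendsto g' atTop (𝓝 c)) : Tendsto (fun x => g x / x) atTop (𝓝 c) := by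
  have hsub : (fun x => g x - x * c) =o[atTop] id :=
    isLittleO_id_of_tendsto_deriv_zero (fun x => (hg x).sub (hasDerivAt_mul_const c))
      (sub_self c ▸ hlim.sub_const c)
  refine (zero_add c ▸ hsub.tendsto_div_nhds_zero.add_const c).congr' ?_
  filter_upwards [eventually_ne_atTop 0] with x hx
  rw [id]; field_simp; ring

theorem tendsto_log_one_div_nhdsGT_zero :
    Tendsto (fun l : ℝ => Real.log (1 / l)) (𝓝[>] 0) atTop := by
  simpa only [one_div] using! Real.tendsto_log_atTop.comp tendsto_inv_nhdsGT_zero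

theorem LaplaceIntegrable.tendsto_laplace_div_log {f : ℝ → ℝ} {c C : ℝ} (hf : LaplaceIntegrable f)
    (hmeas : Measurable f) (hC : ∀ t, 0 < t → |t * f t| ≤ C)
    (hlim : Tendsto (fun t => t * f t) atTop (𝓝 c)) :
    Tendsto (fun l => laplace f l / Real.log (1 / l)) (𝓝[>] 0) (𝓝 c) := by
  have hderiv : ∀ x, HasDerivAt (fun x => laplace f (Real.exp (-x)))
      (Real.exp (-x) * laplace (fun t => t * f t) (Real.exp (-x))) x := fun x => by
    convert! (hf.hasDerivAt_laplace (Real.exp_pos (-x))).comp x (hasDerivAt_neg x).exp using 1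
    ring
  have hmul : Tendsto (fun l => l * laplace (fun t => t * f t) l) (𝓝[>] 0) (𝓝 c) := by
    simpa only [sub_zero, Real.rpow_one, Real.Gamma_one, mul_one] using
      tendsto_rpow_mul_laplace (f := fun t => t * f t) (α := 0) (by fun_prop) one_pos
        (by simpa using hC) (by simpa using hlim)
  have hlog := tendsto_div_id_of_tendsto_deriv hderiv
    (hmul.comp (tendsto_nhdsWithin_iff.2
      ⟨Real.tendsto_exp_neg_atTop_nhds_zero, .of_forall fun x => Real.exp_pos _⟩))
  refine (hlog.comp tendsto_log_one_div_nhdsGT_zero).congr' ?_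
  filter_upwards [self_mem_nhdsWithin] with l (hl : 0 < l)
  rw [Function.comp_apply, one_div, Real.log_inv, neg_neg, Real.exp_log hl]

theorem laplace_pos {f : ℝ → ℝ} {l : ℝ} (hf : LaplaceIntegrable f) (hf₀ : ∀ t, 0 < t → 0 ≤ f t)
    (hpos : ∀ᶠ t in 𝓝[>] 0, 0 < f t) (hl : 0 < l) : 0 < laplace f l := by
  obtain ⟨ε, hε, hεpos⟩ := mem_nhdsGT_iff_exists_Ioo_subset.1 hpos
  refine (setIntegral_pos_iff_support_of_nonneg_ae ?_ (hf l hl)).2 ?_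
  · filter_upwards [ae_restrict_mem measurableSet_Ioi] with t ht
    exact mul_nonneg (Real.exp_nonneg _) (hf₀ t ht)
  · refine lt_of_lt_of_le ?_ (measure_mono (s := Ioo 0 ε) fun t ht =>
      ⟨(mul_pos (Real.exp_pos _) (hεpos ht)).ne', ht.1⟩)
    simpa using hε

/-- The properties of the return probabilities `t ↦ p_t(i,i)` on which the asymptotic analysis is
based: a measurable function with values in `[0, 1]` that is continuous at `0` with value `1`
(a standard `p`-function in Kingman's sense, without the compatibility inequalities). -/
structure IsReturnFunction (p : ℝ → ℝ) : Prop where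
  measurable : Measurable p
  nonneg : ∀ t, 0 ≤ p t
  le_one : ∀ t, p t ≤ 1
  tendsto_one : Tendsto p (𝓝[>] 0) (𝓝 1)

/-- The total mass `∫_0^∞ p(t) dt ∈ [0, ∞]`, which is `G_∞` for return probabilities. -/
def mass (p : ℝ → ℝ) : ℝ≥0∞ :=
  ∫⁻ t in Ioi (0 : ℝ), ENNReal.ofReal (p t)

/-- The critical parameter `1 / ∫_0^∞ p(t) dt`, with `1 / ∞ = 0`. -/
def criticalValue (p : ℝ → ℝ) : ℝ :=
  ((mass p)⁻¹).toReal

/-- The Malthusian parameter of the renewal equation with kernel `κ p`: the positive root `l` of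
`κ * laplace p l = 1`, or `0` if there is none. -/
def rate (p : ℝ → ℝ) (κ : ℝ) : ℝ :=
  sInf {l | 0 < l ∧ κ * laplace p l < 1}

theorem bddBelow_rate (p : ℝ → ℝ) (κ : ℝ) : BddBelow {l | 0 < l ∧ κ * laplace p l < 1} :=
  ⟨0, fun _ hl => hl.1.le⟩

theorem rate_nonneg (p : ℝ → ℝ) (κ : ℝ) : 0 ≤ rate p κ :=
  Real.sInf_nonneg fun _ hl => hl.1.le

theorem criticalValue_eq_zero {p : ℝ → ℝ} (hmass : mass p = ⊤) : criticalValue p = 0 := by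
  rw [criticalValue, hmass, ENNReal.inv_top, ENNReal.toReal_zero]

theorem pos_of_criticalValue_lt {p : ℝ → ℝ} {κ : ℝ} (h : criticalValue p < κ) : 0 < κ :=
  ENNReal.toReal_nonneg.trans_lt h

namespace IsReturnFunction

variable {p : ℝ → ℝ} {κ l : ℝ}

theorem abs_le_one (hp : IsReturnFunction p) (t : ℝ) : |p t| ≤ 1 := by
  rw [abs_of_nonneg (hp.nonneg t)]
  exact hp.le_one t

theorem laplaceIntegrable (hp : IsReturnFunction p) : LaplaceIntegrable p :=
  laplaceIntegrable_of_abs_le hp.measurable hp.abs_le_one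

theorem laplace_pow_mul_pos (hp : IsReturnFunction p) (n : ℕ) (hl : 0 < l) :
    0 < laplace (fun t => t ^ n * p t) l := by
  refine laplace_pos (hp.laplaceIntegrable.pow_mul n)
    (fun t ht => mul_nonneg (pow_nonneg ht.le n) (hp.nonneg t)) ?_ hl
  filter_upwards [self_mem_nhdsWithin, hp.tendsto_one.eventually (lt_mem_nhds one_pos)]
    with t (ht : 0 < t) hpt
  exact mul_pos (pow_pos ht n) hpt

theorem laplace_pos (hp : IsReturnFunction p) (hl : 0 < l) : 0 < laplace p l := by
  simpa only [pow_zero, one_mul] using hp.laplace_pow_mul_pos 0 hl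

theorem hasDerivAt_laplace (hp : IsReturnFunction p) (hl : 0 < l) :
    HasDerivAt (laplace p) (-laplace (fun t => t * p t) l) l :=
  hp.laplaceIntegrable.hasDerivAt_laplace hl

theorem strictAntiOn_laplace (hp : IsReturnFunction p) : StrictAntiOn (laplace p) (Ioi 0) := by
  refine strictAntiOn_of_deriv_neg (convex_Ioi 0) hp.laplaceIntegrable.continuousOn_laplace
    fun l hl => ?_
  rw [interior_Ioi] at hl
  rw [(hp.hasDerivAt_laplace hl).deriv, neg_neg_iff_pos]
  simpa only [pow_one] using hp.laplace_pow_mul_pos 1 hl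

theorem mul_laplace_le_one (hp : IsReturnFunction p) (hl : 0 < l) : l * laplace p l ≤ 1 := by
  rw [mul_laplace_eq_integral_comp_div p hl, ← integral_exp_neg_Ioi_zero]
  refine integral_mono_of_nonneg (ae_of_all _ fun s => ?_) (integrableOn_exp_neg_Ioi 0)
    (ae_of_all _ fun s => ?_)
  · exact mul_nonneg (Real.exp_nonneg _) (hp.nonneg _)
  · exact mul_le_of_le_one_right (Real.exp_nonneg _) (hp.le_one _)

theorem ofReal_laplace (hp : IsReturnFunction p) (hl : 0 < l) :
    ENNReal.ofReal (laplace p l) =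
      ∫⁻ t in Ioi (0 : ℝ), ENNReal.ofReal (Real.exp (-(l * t)) * p t) :=
  ofReal_integral_eq_lintegral_ofReal (hp.laplaceIntegrable l hl)
    (ae_of_all _ fun t => mul_nonneg (Real.exp_nonneg _) (hp.nonneg t))

theorem ofReal_laplace_le_mass (hp : IsReturnFunction p) (hl : 0 < l) :
    ENNReal.ofReal (laplace p l) ≤ mass p := by
  rw [hp.ofReal_laplace hl]
  refine setLIntegral_mono' measurableSet_Ioi fun t (ht : 0 < t) => ENNReal.ofReal_le_ofReal ?_
  exact mul_le_of_le_one_left (hp.nonneg t) (Real.exp_le_one_iff.2 (by nlinarith))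

theorem mass_pos (hp : IsReturnFunction p) : 0 < mass p :=
  (ENNReal.ofReal_pos.2 (hp.laplace_pos one_pos)).trans_le (hp.ofReal_laplace_le_mass one_pos)

theorem tendsto_ofReal_laplace_one_div (hp : IsReturnFunction p) :
    Tendsto (fun n : ℕ => ENNReal.ofReal (laplace p (1 / ((n : ℝ) + 1)))) atTop (𝓝 (mass p)) := by
  simp only [hp.ofReal_laplace Nat.one_div_pos_of_nat]
  have hmeas := hp.measurable
  refine lintegral_tendsto_of_tendsto_of_monotone (fun n => by fun_prop) ?_ ?_
  · filter_upwards [ae_restrict_mem measurableSet_Ioi] with t (ht : 0 < t) m n hmn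
    have := hp.nonneg t
    dsimp only
    gcongr
  · refine ae_of_all _ fun t => (ENNReal.continuous_ofReal.tendsto _).comp ?_
    have h := ((tendsto_one_div_add_atTop_nhds_zero_nat (𝕜 := ℝ)).mul_const t).neg.rexp
    simpa using h.mul_const (p t)

theorem lt_mass_iff (hp : IsReturnFunction p) {x : ℝ} (hx : 0 ≤ x) :
    ENNReal.ofReal x < mass p ↔ ∃ l, 0 < l ∧ x < laplace p l := by
  refine ⟨fun h => ?_, fun ⟨l, hl, hxl⟩ => ?_⟩
  · obtain ⟨n, hn⟩ := (hp.tendsto_ofReal_laplace_one_div.eventually (lt_mem_nhds h)).exists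
    exact ⟨_, Nat.one_div_pos_of_nat, (ENNReal.ofReal_lt_ofReal_iff_of_nonneg hx).1 hn⟩
  · exact ((ENNReal.ofReal_lt_ofReal_iff_of_nonneg hx).2 hxl).trans_le
      (hp.ofReal_laplace_le_mass hl)

theorem criticalValue_lt_iff (hp : IsReturnFunction p) (hκ : 0 < κ) :
    criticalValue p < κ ↔ ∃ l, 0 < l ∧ 1 < κ * laplace p l := by
  simp only [← inv_lt_iff_one_lt_mul₀' hκ]
  rw [← hp.lt_mass_iff (inv_nonneg.2 hκ.le), criticalValue,
    ← ENNReal.lt_ofReal_iff_toReal_lt (ENNReal.inv_ne_top.2 hp.mass_pos.ne'),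
    ENNReal.inv_lt_iff_inv_lt, ENNReal.ofReal_inv_of_pos hκ]

theorem criticalValue_pos (hp : IsReturnFunction p) (hmass : mass p ≠ ⊤) : 0 < criticalValue p :=
  ENNReal.toReal_pos (ENNReal.inv_ne_zero.2 hmass) (ENNReal.inv_ne_top.2 hp.mass_pos.ne')

theorem mul_laplace_lt_one (hp : IsReturnFunction p) (hl : 0 < l) (hκl : κ < l) :
    κ * laplace p l < 1 :=
  (mul_lt_mul_of_pos_right hκl (hp.laplace_pos hl)).trans_le (hp.mul_laplace_le_one hl)

theorem rate_lt_iff (hp : IsReturnFunction p) (hκ : 0 < κ) (hl : 0 < l) :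
    rate p κ < l ↔ κ * laplace p l < 1 := by
  refine ⟨fun h => ?_, fun h => ?_⟩
  · obtain ⟨x, ⟨hx, hκx⟩, hxl⟩ := (csInf_lt_iff (bddBelow_rate p κ)
      ⟨κ + 1, by positivity, hp.mul_laplace_lt_one (by positivity) (lt_add_one κ)⟩).1 h
    exact (mul_lt_mul_of_pos_left (hp.strictAntiOn_laplace hx hl hxl) hκ).trans hκx
  · have hnear : ∀ᶠ x in 𝓝[<] l, κ * laplace p x < 1 :=
      (((hp.hasDerivAt_laplace hl).continuousAt.const_mul κ).eventually
        (gt_mem_nhds h)).filter_mono nhdsWithin_le_nhds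
    obtain ⟨x, hκx, hx, hxl⟩ := (hnear.and (Ioo_mem_nhdsLT hl)).exists
    exact (csInf_le (bddBelow_rate p κ) ⟨hx, hκx⟩).trans_lt hxl

theorem lt_rate_iff (hp : IsReturnFunction p) (hκ : 0 < κ) (hl : 0 < l) :
    l < rate p κ ↔ 1 < κ * laplace p l := by
  refine ⟨fun h => ?_, fun h => ?_⟩
  · refine (not_lt.1 fun hlt => h.not_gt ((hp.rate_lt_iff hκ hl).2 hlt)).lt_of_ne fun heq => ?_
    refine h.not_ge (le_of_forall_gt_imp_ge_of_dense fun x hx => le_of_lt ?_)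
    rw [hp.rate_lt_iff hκ (hl.trans hx), heq]
    exact mul_lt_mul_of_pos_left (hp.strictAntiOn_laplace hl (hl.trans hx) hx) hκ
  · have hnear : ∀ᶠ x in 𝓝[>] l, 1 < κ * laplace p x :=
      (((hp.hasDerivAt_laplace hl).continuousAt.const_mul κ).eventually
        (lt_mem_nhds h)).filter_mono nhdsWithin_le_nhds
    obtain ⟨x, hκx, hlx⟩ := (hnear.and self_mem_nhdsWithin).exists
    exact lt_of_lt_of_le hlx (not_lt.1 fun hlt =>
      hκx.not_gt ((hp.rate_lt_iff hκ (hl.trans hlx)).1 hlt))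

theorem mul_laplace_rate (hp : IsReturnFunction p) (hκ : 0 < κ) (hrate : 0 < rate p κ) :
    κ * laplace p (rate p κ) = 1 :=
  le_antisymm (not_lt.1 fun h => lt_irrefl _ ((hp.lt_rate_iff hκ hrate).2 h))
    (not_lt.1 fun h => lt_irrefl _ ((hp.rate_lt_iff hκ hrate).2 h))

theorem rate_pos_iff (hp : IsReturnFunction p) (hκ : 0 < κ) :
    0 < rate p κ ↔ criticalValue p < κ := by
  rw [hp.criticalValue_lt_iff hκ]
  refine ⟨fun h => ?_, fun ⟨_, hl, h⟩ => hl.trans ((hp.lt_rate_iff hκ hl).2 h)⟩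
  exact ⟨_, half_pos h, (hp.lt_rate_iff hκ (half_pos h)).1 (half_lt_self h)⟩

theorem rate_pos (hp : IsReturnFunction p) (hκ : criticalValue p < κ) : 0 < rate p κ :=
  (hp.rate_pos_iff (pos_of_criticalValue_lt hκ)).2 hκ

theorem rate_le (hp : IsReturnFunction p) (hκ : 0 < κ) : rate p κ ≤ κ :=
  le_of_forall_gt_imp_ge_of_dense fun _ hl =>
    ((hp.rate_lt_iff hκ (hκ.trans hl)).2 (hp.mul_laplace_lt_one (hκ.trans hl) hl)).le

theorem tendsto_rate_atTop (hp : IsReturnFunction p) : Tendsto (rate p) atTop atTop := by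
  refine tendsto_atTop.2 fun b => ?_
  have hl : 0 < max b 1 := lt_max_of_lt_right one_pos
  filter_upwards [eventually_gt_atTop 0,
    (tendsto_id.atTop_mul_const (hp.laplace_pos hl)).eventually_gt_atTop 1] with κ hκ h
  exact (le_max_left b 1).trans ((hp.lt_rate_iff hκ hl).2 h).le

theorem tendsto_rate_div_atTop (hp : IsReturnFunction p) :
    Tendsto (fun κ => rate p κ / κ) atTop (𝓝 1) := by
  refine ((tendsto_mul_laplace_atTop hp.measurable hp.abs_le_one hp.tendsto_one).comp
    hp.tendsto_rate_atTop).congr' ?_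
  filter_upwards [eventually_gt_atTop 0, hp.tendsto_rate_atTop.eventually_gt_atTop 0]
    with κ hκ hrate
  rw [Function.comp_apply, eq_div_iff hκ.ne', mul_assoc, mul_comm _ κ, hp.mul_laplace_rate hκ hrate,
    mul_one]

theorem criticalValue_mul_laplace_lt_one (hp : IsReturnFunction p) (hl : 0 < l) :
    criticalValue p * laplace p l < 1 := by
  by_contra! h
  have hcr : 0 < criticalValue p := pos_of_mul_pos_left (one_pos.trans_le h) (hp.laplace_pos hl).le
  refine lt_irrefl _ ((hp.criticalValue_lt_iff hcr).2 ⟨l / 2, half_pos hl, h.trans_lt ?_⟩)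
  exact mul_lt_mul_of_pos_left (hp.strictAntiOn_laplace (half_pos hl) hl (half_lt_self hl)) hcr

theorem tendsto_rate_criticalValue (hp : IsReturnFunction p) :
    Tendsto (rate p) (𝓝[>] (criticalValue p)) (𝓝[>] 0) := by
  refine tendsto_nhdsWithin_iff.2 ⟨tendsto_order.2 ⟨fun b hb => ?_, fun b hb => ?_⟩,
    eventually_nhdsWithin_of_forall fun κ hκ => hp.rate_pos hκ⟩
  · exact .of_forall fun κ => hb.trans_le (rate_nonneg p κ)
  · have hcont : ContinuousAt (fun κ => κ * laplace p b) (criticalValue p) := by fun_prop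
    filter_upwards [self_mem_nhdsWithin, (hcont.eventually (gt_mem_nhds
      (hp.criticalValue_mul_laplace_lt_one hb))).filter_mono nhdsWithin_le_nhds] with κ hκ h
    exact (hp.rate_lt_iff (pos_of_criticalValue_lt hκ) hb).2 h

end IsReturnFunction

theorem isEquivalent_of_tendsto_rpow_div {F : Filter ℝ} {f δ : ℝ → ℝ} {γ A : ℝ} (hγ : 0 < γ)
    (hA : 0 < A) (hf : ∀ᶠ x in F, 0 < f x) (hδ : ∀ᶠ x in F, 0 < δ x)
    (h : Tendsto (fun x => f x ^ γ / δ x) F (𝓝 A)) :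
    f ~[F] fun x => δ x ^ (1 / γ) * A ^ (1 / γ) := by
  have hroot := (h.rpow_const (Or.inl hA.ne') (p := 1 / γ)).div_const (A ^ (1 / γ))
  rw [div_self (Real.rpow_pos_of_pos hA _).ne'] at hroot
  refine isEquivalent_of_tendsto_one (hroot.congr' ?_)
  filter_upwards [hf, hδ] with x hx hy
  rw [Real.div_rpow (Real.rpow_nonneg hx.le _) hy.le, ← Real.rpow_mul hx.le,
    mul_one_div_cancel hγ.ne', Real.rpow_one, div_div, Pi.div_apply]

theorem tendsto_log_one_div_div_log_one_div {F : Filter ℝ} {f δ : ℝ → ℝ} {A : ℝ} (hA : 0 < A)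
    (hf : Tendsto f F (𝓝[>] 0)) (hδ : ∀ᶠ x in F, 0 < δ x)
    (h : Tendsto (fun x => f x * Real.log (1 / f x) / δ x) F (𝓝 A)) :
    Tendsto (fun x => Real.log (1 / δ x) / Real.log (1 / f x)) F (𝓝 1) := by
  have hlog := tendsto_log_one_div_nhdsGT_zero.comp hf
  have hratio := (h.log hA.ne').div_atTop hlog
  have hloglog := Real.isLittleO_log_id_atTop.tendsto_div_nhds_zero.comp hlog
  have hlim := (hratio.sub hloglog).add_const 1
  rw [sub_zero, zero_add] at hlim
  refine hlim.congr' ?_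
  filter_upwards [hf.eventually self_mem_nhdsWithin, hδ, hlog.eventually_gt_atTop 0]
    with x (hx : 0 < f x) hy hL
  simp only [Function.comp_apply, id_eq] at hL ⊢
  rw [Real.log_div (mul_pos hx hL).ne' hy.ne', Real.log_mul hx.ne' hL.ne', ← sub_div,
    div_add_one hL.ne', one_div (δ x), one_div (f x), Real.log_inv, Real.log_inv]
  ring

theorem isEquivalent_div_log_of_tendsto {F : Filter ℝ} {f δ : ℝ → ℝ} {A : ℝ} (hA : 0 < A)
    (hf : Tendsto f F (𝓝[>] 0)) (hδ : ∀ᶠ x in F, 0 < δ x)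
    (h : Tendsto (fun x => f x * Real.log (1 / f x) / δ x) F (𝓝 A)) :
    f ~[F] fun x => δ x / Real.log (1 / δ x) * A := by
  have hlim := (h.mul (tendsto_log_one_div_div_log_one_div hA hf hδ h)).div_const A
  rw [mul_one, div_self hA.ne'] at hlim
  refine isEquivalent_of_tendsto_one (hlim.congr' ?_)
  filter_upwards [hδ, (tendsto_log_one_div_nhdsGT_zero.comp hf).eventually_gt_atTop 0]
    with x hy (hL : 0 < Real.log (1 / f x))
  rw [Pi.div_apply]
  field_simp

namespace IsReturnFunction

variable {p : ℝ → ℝ} {α c : ℝ}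

section Tail

theorem exists_abs_mul_rpow_le (hp : IsReturnFunction p) (hα : 0 ≤ α)
    (htail : Tendsto (fun t => p t * t ^ α) atTop (𝓝 c)) :
    ∃ C, ∀ t, 0 < t → |p t * t ^ α| ≤ C := by
  obtain ⟨T, hT⟩ := eventually_atTop.1 (htail.abs.eventually (gt_mem_nhds (lt_add_one |c|)))
  refine ⟨max (|c| + 1) (|T| ^ α), fun t ht => ?_⟩
  rcases le_total T t with h | h
  · exact (hT t h).le.trans (le_max_left _ _)
  · refine le_max_of_le_right ?_
    rw [abs_mul, abs_of_nonneg (Real.rpow_nonneg ht.le α)]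
    exact (mul_le_of_le_one_left (Real.rpow_nonneg ht.le α) (hp.abs_le_one t)).trans
      (Real.rpow_le_rpow ht.le (h.trans (le_abs_self T)) hα)

theorem pow_mul_mul_rpow_sub (p : ℝ → ℝ) (α : ℝ) (n : ℕ) {t : ℝ} (ht : 0 < t) :
    t ^ n * p t * t ^ (α - n) = p t * t ^ α := by
  rw [Real.rpow_sub_natCast ht.ne']
  field_simp

theorem tendsto_pow_mul_mul_rpow_sub (htail : Tendsto (fun t => p t * t ^ α) atTop (𝓝 c)) (n : ℕ) :
    Tendsto (fun t => t ^ n * p t * t ^ (α - n)) atTop (𝓝 c) :=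
  htail.congr' ((eventually_gt_atTop 0).mono fun _ ht => (pow_mul_mul_rpow_sub p α n ht).symm)

theorem tendsto_rpow_mul_laplace_pow_mul (hp : IsReturnFunction p) (hα : 0 ≤ α)
    (htail : Tendsto (fun t => p t * t ^ α) atTop (𝓝 c)) {n : ℕ} (hn : α < n + 1) :
    Tendsto (fun l => l ^ (n + 1 - α) * laplace (fun t => t ^ n * p t) l) (𝓝[>] 0)
      (𝓝 (c * Real.Gamma (n + 1 - α))) := by
  obtain ⟨C, hC⟩ := hp.exists_abs_mul_rpow_le hα htail
  have hmeas := hp.measurable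
  rw [show n + 1 - α = 1 - (α - n) by ring]
  exact tendsto_rpow_mul_laplace (f := fun t => t ^ n * p t) (by fun_prop) (by linarith)
    (fun t ht => by rw [pow_mul_mul_rpow_sub p α n ht]; exact hC t ht)
    (tendsto_pow_mul_mul_rpow_sub htail n)

theorem tendsto_laplace_pow_mul_div_log (hp : IsReturnFunction p) {n : ℕ}
    (htail : Tendsto (fun t => p t * t ^ (n + 1 : ℝ)) atTop (𝓝 c)) :
    Tendsto (fun l => laplace (fun t => t ^ n * p t) l / Real.log (1 / l)) (𝓝[>] 0) (𝓝 c) := by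
  obtain ⟨C, hC⟩ := hp.exists_abs_mul_rpow_le (by positivity) htail
  have hmeas := hp.measurable
  have hpow : ∀ t : ℝ, t * (t ^ n * p t) = p t * t ^ (n + 1 : ℝ) := fun t => by
    rw [← Nat.cast_succ, Real.rpow_natCast, pow_succ]
    ring
  exact (hp.laplaceIntegrable.pow_mul n).tendsto_laplace_div_log (by fun_prop)
    (fun t ht => hpow t ▸ hC t ht) (htail.congr fun t => (hpow t).symm)

theorem integrableOn_pow_mul (hp : IsReturnFunction p)
    (htail : Tendsto (fun t => p t * t ^ α) atTop (𝓝 c)) {n : ℕ} (hn : n + 1 < α) :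
    IntegrableOn (fun t => t ^ n * p t) (Ioi 0) := by
  have hmeas := hp.measurable
  have hloc : LocallyIntegrable (fun t => t ^ n * p t) :=
    (continuous_pow n).locallyIntegrable.mono (by fun_prop) (ae_of_all _ fun t => by
      rw [norm_mul]
      exact mul_le_of_le_one_right (norm_nonneg _) (hp.abs_le_one t))
  have hO : (fun t => t ^ n * p t) =O[atTop] fun t : ℝ => t ^ (n - α) := by
    have h := ((tendsto_pow_mul_mul_rpow_sub htail n).isBigO_one ℝ).mul
      (isBigO_refl (fun t : ℝ => t ^ (n - α)) atTop)
    simp only [one_mul] at h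
    refine h.congr' ((eventually_gt_atTop 0).mono fun t ht => ?_) .rfl
    simp only [mul_assoc, ← Real.rpow_add ht, sub_add_sub_cancel, sub_self, Real.rpow_zero, mul_one]
  exact (hloc.locallyIntegrableOn _ |>.integrableOn_of_isBigO_atTop hO
    (integrableAtFilter_rpow_atTop_iff.2 (by linarith))).mono_set Ioi_subset_Ici_self

theorem integrableOn_mul (hp : IsReturnFunction p)
    (htail : Tendsto (fun t => p t * t ^ α) atTop (𝓝 c)) (hα : 2 < α) :
    IntegrableOn (fun t => t * p t) (Ioi 0) := by
  simpa only [pow_one] using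
    hp.integrableOn_pow_mul htail (n := 1) (by rwa [Nat.cast_one, one_add_one_eq_two])

theorem ae_mul_nonneg (hp : IsReturnFunction p) :
    0 ≤ᵐ[volume.restrict (Ioi 0)] fun t => t * p t := by
  filter_upwards [ae_restrict_mem measurableSet_Ioi] with t (ht : 0 < t)
  exact mul_nonneg ht.le (hp.nonneg t)

theorem lintegral_mul_ne_top (hp : IsReturnFunction p)
    (htail : Tendsto (fun t => p t * t ^ α) atTop (𝓝 c)) (hα : 2 < α) :
    ∫⁻ t in Ioi (0 : ℝ), ENNReal.ofReal (t * p t) ≠ ⊤ :=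
  ((hasFiniteIntegral_iff_ofReal hp.ae_mul_nonneg).1
    (hp.integrableOn_mul htail hα).hasFiniteIntegral).ne

theorem toReal_lintegral_mul (hp : IsReturnFunction p) :
    (∫⁻ t in Ioi (0 : ℝ), ENNReal.ofReal (t * p t)).toReal = ∫ t in Ioi (0 : ℝ), t * p t :=
  (integral_eq_lintegral_of_nonneg_ae hp.ae_mul_nonneg
    (measurable_id.mul hp.measurable).aestronglyMeasurable).symm

theorem integral_mul_pos (hp : IsReturnFunction p)
    (hint : IntegrableOn (fun t => t * p t) (Ioi 0)) : 0 < ∫ t in Ioi (0 : ℝ), t * p t := by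
  have hpos : 0 < laplace (fun t => t * p t) 1 := by
    simpa only [pow_one] using hp.laplace_pow_mul_pos 1 one_pos
  refine hpos.trans_le (setIntegral_mono_on (hp.laplaceIntegrable.id_mul 1 one_pos) hint
    measurableSet_Ioi fun t (ht : 0 < t) => ?_)
  exact mul_le_of_le_one_left (mul_nonneg ht.le (hp.nonneg t))
    (Real.exp_le_one_iff.2 (by linarith))

theorem mass_ne_top_iff (hp : IsReturnFunction p) : mass p ≠ ⊤ ↔ IntegrableOn p (Ioi 0) := by
  rw [← lt_top_iff_ne_top, mass, ← hasFiniteIntegral_iff_ofReal (ae_of_all _ hp.nonneg),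
    IntegrableOn, Integrable, and_iff_right hp.measurable.aestronglyMeasurable]

theorem mass_ne_top (hp : IsReturnFunction p)
    (htail : Tendsto (fun t => p t * t ^ α) atTop (𝓝 c)) (hα : 1 < α) : mass p ≠ ⊤ :=
  hp.mass_ne_top_iff.2 (by simpa using hp.integrableOn_pow_mul htail (n := 0) (by simpa using hα))

theorem mass_eq_top (hp : IsReturnFunction p) (hc : 0 < c)
    (htail : Tendsto (fun t => p t * t ^ α) atTop (𝓝 c)) (hα : α ≤ 1) : mass p = ⊤ := by
  by_contra hmass
  have hint : IntegrableAtFilter p atTop :=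
    ⟨Ioi 0, Ioi_mem_atTop 0, hp.mass_ne_top_iff.1 hmass⟩
  have hO : (fun t : ℝ => t ^ (-α)) =O[atTop] p := by
    refine .of_bound (2 / c) ?_
    filter_upwards [htail.eventually (lt_mem_nhds (half_lt_self hc)), eventually_gt_atTop 0]
      with t hlt ht
    rw [Real.norm_of_nonneg (by positivity), Real.norm_of_nonneg (hp.nonneg t), Real.rpow_neg ht.le,
      inv_le_iff_one_le_mul₀ (by positivity)]
    field_simp
    linarith
  have := integrableAtFilter_rpow_atTop_iff.1 (hO.integrableAtFilter
    ⟨univ, univ_mem, (measurable_id.pow_const _).aestronglyMeasurable⟩ hint)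
  linarith

end Tail

section CriticalAsymptotics

variable {κ : ℝ}

theorem toReal_mass (hp : IsReturnFunction p) : (mass p).toReal = ∫ t in Ioi (0 : ℝ), p t :=
  (integral_eq_lintegral_of_nonneg_ae (ae_of_all _ hp.nonneg)
    hp.measurable.aestronglyMeasurable).symm

theorem tendsto_mass_sub_laplace_div (hp : IsReturnFunction p) (hmass : mass p ≠ ⊤)
    {g g' : ℝ → ℝ} {B : ℝ} (hg : ∀ l, 0 < l → HasDerivAt g (g' l) l)
    (hg' : ∀ᶠ l in 𝓝[>] 0, g' l ≠ 0) (hg₀ : Tendsto g (𝓝[>] 0) (𝓝 0))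
    (h : Tendsto (fun l => laplace (fun t => t * p t) l / g' l) (𝓝[>] 0) (𝓝 B)) :
    Tendsto (fun l => ((mass p).toReal - laplace p l) / g l) (𝓝[>] 0) (𝓝 B) := by
  have hlim := (tendsto_laplace_nhdsGT_zero (hp.mass_ne_top_iff.1 hmass)).const_sub (mass p).toReal
  rw [← hp.toReal_mass, sub_self] at hlim
  refine HasDerivAt.lhopital_zero_nhdsGT (eventually_nhdsWithin_of_forall fun l hl => ?_)
    (eventually_nhdsWithin_of_forall hg) hg' hlim hg₀ h
  simpa only [neg_neg] using (hp.hasDerivAt_laplace hl).const_sub _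

theorem tendsto_comp_rate_div (hp : IsReturnFunction p) (hmass : mass p ≠ ⊤)
    {g : ℝ → ℝ} {B : ℝ} (hB : B ≠ 0)
    (h : Tendsto (fun l => ((mass p).toReal - laplace p l) / g l) (𝓝[>] 0) (𝓝 B)) :
    Tendsto (fun κ => g (rate p κ) / (κ - criticalValue p)) (𝓝[>] (criticalValue p))
      (𝓝 ((mass p).toReal ^ 2 / B)) := by
  have hcr := hp.criticalValue_pos hmass
  have hG : (mass p).toReal = (criticalValue p)⁻¹ := by
    rw [criticalValue, ENNReal.toReal_inv, inv_inv]
  have hκ : Tendsto (fun κ => (κ * criticalValue p)⁻¹) (𝓝[>] (criticalValue p))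
      (𝓝 ((criticalValue p * criticalValue p)⁻¹)) :=
    ((tendsto_id.mul_const _).inv₀ (mul_pos hcr hcr).ne').mono_left nhdsWithin_le_nhds
  have hlim := hκ.mul ((h.comp hp.tendsto_rate_criticalValue).inv₀ hB)
  rw [← sq, ← inv_pow, ← hG, ← div_eq_mul_inv] at hlim
  refine hlim.congr' (eventually_nhdsWithin_of_forall fun κ (hlt : criticalValue p < κ) => ?_)
  have hκ₀ : 0 < κ := hcr.trans hlt
  have hsub : κ - criticalValue p ≠ 0 := (sub_pos.2 hlt).ne'
  have hL : laplace p (rate p κ) = κ⁻¹ :=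
    eq_inv_of_mul_eq_one_right (hp.mul_laplace_rate hκ₀ (hp.rate_pos hlt))
  have hdiff : (mass p).toReal - laplace p (rate p κ) =
      (κ - criticalValue p) / (κ * criticalValue p) := by
    rw [hG, hL]; field_simp
  rw [Function.comp_apply, hdiff, inv_div]
  field_simp

theorem eventually_sub_criticalValue_pos (p : ℝ → ℝ) :
    ∀ᶠ κ in 𝓝[>] (criticalValue p), 0 < κ - criticalValue p :=
  eventually_nhdsWithin_of_forall fun _ hκ => sub_pos.2 hκ

theorem isEquivalent_rate_of_lt_one (hp : IsReturnFunction p) (hc : 0 < c)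
    (htail : Tendsto (fun t => p t * t ^ α) atTop (𝓝 c)) (hα₀ : 0 ≤ α) (hα : α < 1) :
    rate p ~[𝓝[>] 0] fun κ : ℝ =>
      κ ^ (1 / (1 - α)) * (c * Real.Gamma (1 - α)) ^ (1 / (1 - α)) := by
  have hcr : criticalValue p = 0 := criticalValue_eq_zero (hp.mass_eq_top hc htail hα.le)
  have hlim := (hp.tendsto_rpow_mul_laplace_pow_mul hα₀ htail (n := 0) (by simpa using hα)).comp
    hp.tendsto_rate_criticalValue
  simp only [CharP.cast_eq_zero, zero_add, pow_zero, one_mul, hcr] at hlim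
  have hpos : ∀ᶠ κ in 𝓝[>] 0, 0 < rate p κ :=
    eventually_nhdsWithin_of_forall fun κ hκ => hp.rate_pos (hcr ▸ hκ)
  refine isEquivalent_of_tendsto_rpow_div (sub_pos.2 hα)
    (mul_pos hc (Real.Gamma_pos_of_pos (sub_pos.2 hα))) hpos self_mem_nhdsWithin (hlim.congr' ?_)
  filter_upwards [hpos, self_mem_nhdsWithin] with κ hrate (hκ : 0 < κ)
  rw [Function.comp_apply, eq_inv_of_mul_eq_one_right (hp.mul_laplace_rate hκ hrate),
    div_eq_mul_inv]

theorem isEquivalent_rate_of_eq_one (hp : IsReturnFunction p) (hc : 0 < c)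
    (htail : Tendsto (fun t => p t * t ^ (1 : ℝ)) atTop (𝓝 c)) :
    ∃ ε : ℝ → ℝ, ε =o[𝓝[>] 0] (fun κ : ℝ => κ⁻¹) ∧
      rate p ~[𝓝[>] 0] fun κ : ℝ => Real.exp (-(c * κ)⁻¹ + ε κ) := by
  have hcr : criticalValue p = 0 := criticalValue_eq_zero (hp.mass_eq_top hc htail le_rfl)
  have hlim := ((hp.tendsto_laplace_pow_mul_div_log (n := 0) (by simpa using htail)).inv₀
    hc.ne').comp hp.tendsto_rate_criticalValue
  simp only [pow_zero, one_mul, hcr] at hlim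
  have hpos : ∀ᶠ κ in 𝓝[>] 0, 0 < rate p κ :=
    eventually_nhdsWithin_of_forall fun κ hκ => hp.rate_pos (hcr ▸ hκ)
  refine ⟨fun κ => Real.log (rate p κ) + (c * κ)⁻¹, ?_, ?_⟩
  · refine isLittleO_of_tendsto' (eventually_nhdsWithin_of_forall fun κ hκ h =>
      absurd h (inv_pos.2 hκ).ne') ?_
    refine (sub_self c⁻¹ ▸ hlim.const_sub c⁻¹).congr' ?_
    filter_upwards [hpos, self_mem_nhdsWithin] with κ hrate (hκ : 0 < κ)
    rw [Function.comp_apply, eq_inv_of_mul_eq_one_right (hp.mul_laplace_rate hκ hrate), one_div,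
      Real.log_inv]
    field_simp
    ring
  · refine IsEquivalent.refl.congr_right (hpos.mono fun κ hrate => ?_)
    simp only [add_comm (Real.log _), neg_add_cancel_left, Real.exp_log hrate]

theorem isEquivalent_rate_of_lt_two (hp : IsReturnFunction p) (hc : 0 < c)
    (htail : Tendsto (fun t => p t * t ^ α) atTop (𝓝 c)) (hα₁ : 1 < α) (hα₂ : α < 2) :
    rate p ~[𝓝[>] (criticalValue p)] fun κ : ℝ =>
      (κ - criticalValue p) ^ (1 / (α - 1)) *
        ((mass p).toReal ^ 2 * (α - 1) / (c * Real.Gamma (2 - α))) ^ (1 / (α - 1)) := by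
  have hmass := hp.mass_ne_top htail hα₁
  have hG : 0 < (mass p).toReal := ENNReal.toReal_pos hp.mass_pos.ne' hmass
  have hΓ : 0 < Real.Gamma (2 - α) := Real.Gamma_pos_of_pos (sub_pos.2 hα₂)
  have hα : 0 < α - 1 := sub_pos.2 hα₁
  have hmoment : Tendsto (fun l => laplace (fun t => t * p t) l / ((α - 1) * l ^ (α - 1 - 1)))
      (𝓝[>] 0) (𝓝 (c * Real.Gamma (2 - α) / (α - 1))) := by
    have h := (hp.tendsto_rpow_mul_laplace_pow_mul (by linarith) htail (n := 1)
      (by norm_num; exact hα₂)).div_const (α - 1)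
    simp only [pow_one, Nat.cast_one, one_add_one_eq_two] at h
    refine h.congr' (eventually_nhdsWithin_of_forall fun l (hl : 0 < l) => ?_)
    simp only [show α - 1 - 1 = -(2 - α) by ring, Real.rpow_neg hl.le]
    field_simp
  have hroot : Tendsto (fun l : ℝ => l ^ (α - 1)) (𝓝[>] 0) (𝓝 0) :=
    Tendsto.rpow_const_nhds_zero nhdsWithin_le_nhds hα
  have h := hp.tendsto_comp_rate_div hmass (div_pos (mul_pos hc hΓ) hα).ne'
    (hp.tendsto_mass_sub_laplace_div hmass
      (fun l hl => Real.hasDerivAt_rpow_const (Or.inl hl.ne'))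
      (eventually_nhdsWithin_of_forall fun l (hl : 0 < l) => by positivity) hroot hmoment)
  rw [div_div_eq_mul_div] at h
  exact isEquivalent_of_tendsto_rpow_div hα (by positivity)
    (eventually_nhdsWithin_of_forall fun κ hκ => hp.rate_pos hκ)
    (eventually_sub_criticalValue_pos p) h

theorem isEquivalent_rate_of_eq_two (hp : IsReturnFunction p) (hc : 0 < c)
    (htail : Tendsto (fun t => p t * t ^ (2 : ℝ)) atTop (𝓝 c)) :
    rate p ~[𝓝[>] (criticalValue p)] fun κ : ℝ =>
      (κ - criticalValue p) / Real.log (1 / (κ - criticalValue p)) *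
        ((mass p).toReal ^ 2 / c) := by
  have hmass := hp.mass_ne_top htail one_lt_two
  have hG : 0 < (mass p).toReal := ENNReal.toReal_pos hp.mass_pos.ne' hmass
  have hlog := tendsto_log_one_div_nhdsGT_zero
  have hderiv : ∀ l : ℝ, 0 < l →
      HasDerivAt (fun l => l * Real.log (1 / l)) (Real.log (1 / l) - 1) l := fun l hl => by
    simp only [one_div, Real.log_inv, mul_neg]
    convert! (Real.hasDerivAt_mul_log hl.ne').fun_neg using 1
    ring
  have hmoment : Tendsto (fun l => laplace (fun t => t * p t) l / (Real.log (1 / l) - 1))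
      (𝓝[>] 0) (𝓝 c) := by
    have h := (hp.tendsto_laplace_pow_mul_div_log (n := 1)
      (by simpa only [Nat.cast_one, one_add_one_eq_two] using htail)).div
      (((tendsto_const_nhds (x := (1 : ℝ))).div_atTop hlog).const_sub 1)
      (by norm_num : (1 - 0 : ℝ) ≠ 0)
    simp only [pow_one, sub_zero, div_one] at h
    refine h.congr' ?_
    filter_upwards [hlog.eventually_gt_atTop 1] with l hL
    have := sub_pos.2 hL
    rw [Pi.div_apply]
    field_simp
  have hzero : Tendsto (fun l : ℝ => l * Real.log (1 / l)) (𝓝[>] 0) (𝓝 0) := by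
    simp only [one_div, Real.log_inv, mul_neg]
    simpa using! (Real.continuous_mul_log.neg.tendsto 0).mono_left nhdsWithin_le_nhds
  refine isEquivalent_div_log_of_tendsto (by positivity) hp.tendsto_rate_criticalValue
    (eventually_sub_criticalValue_pos p) (hp.tendsto_comp_rate_div hmass hc.ne'
      (hp.tendsto_mass_sub_laplace_div hmass hderiv ?_ hzero hmoment))
  filter_upwards [hlog.eventually_gt_atTop 1] with l hL using (sub_pos.2 hL).ne'

theorem isEquivalent_rate_of_two_lt (hp : IsReturnFunction p)
    (htail : Tendsto (fun t => p t * t ^ α) atTop (𝓝 c)) (hα : 2 < α) :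
    rate p ~[𝓝[>] (criticalValue p)] fun κ : ℝ =>
      (κ - criticalValue p) *
        ((mass p).toReal ^ 2 / (∫⁻ t in Ioi (0 : ℝ), ENNReal.ofReal (t * p t)).toReal) := by
  rw [hp.toReal_lintegral_mul]
  have hmass := hp.mass_ne_top htail (by linarith)
  have hG : 0 < (mass p).toReal := ENNReal.toReal_pos hp.mass_pos.ne' hmass
  have hint := hp.integrableOn_mul htail hα
  have h := hp.tendsto_comp_rate_div hmass (hp.integral_mul_pos hint).ne'
    (hp.tendsto_mass_sub_laplace_div hmass (fun l _ => hasDerivAt_id l)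
      (.of_forall fun _ => one_ne_zero) (tendsto_id.mono_left nhdsWithin_le_nhds)
      ((tendsto_laplace_nhdsGT_zero hint).congr fun _ => (div_one _).symm))
  have hroot := isEquivalent_of_tendsto_rpow_div (F := 𝓝[>] (criticalValue p)) one_pos
    (div_pos (pow_pos hG 2) (hp.integral_mul_pos hint))
    (eventually_nhdsWithin_of_forall fun κ hκ => hp.rate_pos hκ)
    (eventually_sub_criticalValue_pos p) (h.congr fun κ => by rw [id_eq, Real.rpow_one])
  simpa only [div_one, Real.rpow_one] using hroot

end CriticalAsymptotics

end IsReturnFunction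

theorem strictConvexOn_of_not_eqOn_affine {s : Set ℝ} {f : ℝ → ℝ} (hf : ConvexOn ℝ s f)
    (h : ∀ x ∈ s, ∀ y ∈ s, x < y → ∀ A B : ℝ, ¬EqOn f (fun z => A * z + B) (Ioo x y)) :
    StrictConvexOn ℝ s f := by
  refine LinearOrder.strictConvexOn_of_lt hf.1 fun x hx y hy hxy a b ha hb hab => ?_
  by_contra! hcon
  obtain ⟨A, B, hAx, hAy⟩ : ∃ A B : ℝ, A * x + B = f x ∧ A * y + B = f y := by
    have := (sub_pos.2 hxy).ne'
    refine ⟨(f y - f x) / (y - x), f x - (f y - f x) / (y - x) * x, by ring, ?_⟩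
    field_simp
    ring
  have hg : ConvexOn ℝ s fun z => f z - (A * z + B) :=
    hf.sub ((((LinearMap.mul ℝ ℝ) A).concaveOn hf.1).add_const B)
  have hm : a • x + b • y ∈ openSegment ℝ x y := ⟨a, b, ha, hb, hab, rfl⟩
  have hchord : 0 ≤ f (a • x + b • y) - (A * (a • x + b • y) + B) := by
    refine sub_nonneg.2 (le_trans (le_of_eq ?_) hcon)
    simp only [smul_eq_mul, ← hAx, ← hAy]
    linear_combination (-B) * hab
  obtain ⟨hxm, hmy⟩ := (openSegment_eq_Ioo hxy).subset hm
  refine h x hx _ (hf.1.openSegment_subset hx hy hm) hxm A B fun z hz => ?_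
  have hzs : z ∈ s := hf.1.ordConnected.out hx hy ⟨hz.1.le, (hz.2.trans hmy).le⟩
  refine sub_eq_zero.1 (le_antisymm ?_ (not_lt.1 fun hneg => ?_))
  · simpa [hAx, hAy] using hg.le_max_of_mem_Icc hx hy ⟨hz.1.le, (hz.2.trans hmy).le⟩
  · have hlt := hg.lt_right_of_left_lt hzs hy
      ((openSegment_eq_Ioo (hz.2.trans hmy)).symm.subset ⟨hz.2, hmy⟩) (hneg.trans_le hchord)
    linarith

theorem LaplaceIntegrable.laplace_pow_mul_mul_pow {f : ℝ → ℝ} {b s : ℝ} (hf : LaplaceIntegrable f)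
    (h : ∀ l, 0 < l → laplace f l * (l + b) = s) (n : ℕ) {l : ℝ} (hl : 0 < l) :
    laplace (fun t => t ^ n * f t) l * (l + b) ^ (n + 1) = n.factorial * s := by
  induction n generalizing l with
  | zero => simpa using h l hl
  | succ n ih =>
    have hderiv := (hf.hasDerivAt_laplace_pow_mul n hl).mul
      (((hasDerivAt_id l).add_const b).pow (n + 1))
    have hconst : (fun x => laplace (fun t => t ^ n * f t) x * (x + b) ^ (n + 1)) =ᶠ[𝓝 l]
        fun _ => n.factorial * s := (eventually_gt_nhds hl).mono fun x hx => ih hx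
    have hzero := hderiv.unique ((hasDerivAt_const l _).congr_of_eventuallyEq hconst)
    simp only [id_eq, add_tsub_cancel_right, Pi.pow_apply] at hzero
    have := ih hl
    rw [Nat.factorial_succ]
    push_cast at hzero ⊢
    linear_combination (n + 1 : ℝ) * this - (l + b) * hzero

namespace IsReturnFunction

section StrictConvexity

variable {p : ℝ → ℝ} {α c κ κ' l : ℝ}

theorem not_forall_laplace_mul_add_eq (hp : IsReturnFunction p) (hα : 0 < α) (hc : 0 < c)
    (htail : Tendsto (fun t => p t * t ^ α) atTop (𝓝 c)) (b s : ℝ) :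
    ¬∀ l, 0 < l → laplace p l * (l + b) = s := fun h => by
  have hs : 0 < s := by
    have hl : 0 < |b| + 1 := by positivity
    rw [← h _ hl]
    exact mul_pos (hp.laplace_pos hl) (by linarith [neg_abs_le b])
  let n := ⌈α⌉₊
  have hn : 0 < n + 1 - α := by linarith [Nat.le_ceil α]
  have hlim := hp.tendsto_rpow_mul_laplace_pow_mul hα.le htail (sub_pos.1 hn)
  have hA : c * Real.Gamma (n + 1 - α) ≠ 0 := (mul_pos hc (Real.Gamma_pos_of_pos hn)).ne'
  have hid : Tendsto (fun l : ℝ => l) (𝓝[>] 0) (𝓝 0) := nhdsWithin_le_nhds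
  have hmoment := fun l hl => hp.laplaceIntegrable.laplace_pow_mul_mul_pow (l := l) h n hl
  have hb : b = 0 := by
    have hcont : Tendsto (fun l : ℝ => (l + b) ^ (n + 1)) (𝓝[>] 0) (𝓝 (b ^ (n + 1))) := by
      have hcont : Continuous fun l : ℝ => (l + b) ^ (n + 1) := by fun_prop
      simpa using (hcont.tendsto 0).mono_left nhdsWithin_le_nhds
    have heq := tendsto_nhds_unique_of_eventuallyEq (hlim.mul hcont)
      ((hid.rpow_const_nhds_zero hn).mul_const (n.factorial * s))
      (eventually_nhdsWithin_of_forall fun l hl => by simp only [mul_assoc, hmoment l hl])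
    rw [zero_mul] at heq
    exact eq_zero_of_pow_eq_zero ((mul_eq_zero.1 heq).resolve_left hA)
  have heq := tendsto_nhds_unique_of_eventuallyEq (hlim.mul (hid.rpow_const_nhds_zero hα))
    tendsto_const_nhds (b := n.factorial * s) (eventually_nhdsWithin_of_forall fun l hl => ?_)
  · rw [mul_zero] at heq
    exact (mul_pos (Nat.cast_pos.2 n.factorial_pos) hs).ne heq
  · beta_reduce
    rw [← hmoment l hl, hb, add_zero, mul_right_comm, ← Real.rpow_add hl, sub_add_cancel, mul_comm,
      ← Nat.cast_succ, Real.rpow_natCast]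

theorem rate_lt_rate (hp : IsReturnFunction p) (hκ : criticalValue p < κ) (h : κ < κ') :
    rate p κ < rate p κ' := by
  have hκ₀ := pos_of_criticalValue_lt hκ
  rw [hp.lt_rate_iff (hκ₀.trans h) (hp.rate_pos hκ), ← hp.mul_laplace_rate hκ₀ (hp.rate_pos hκ)]
  exact mul_lt_mul_of_pos_right h (hp.laplace_pos (hp.rate_pos hκ))

theorem rate_inv_laplace (hp : IsReturnFunction p) (hl : 0 < l) :
    rate p (laplace p l)⁻¹ = l := by
  have hL := hp.laplace_pos hl
  have hroot : (laplace p l)⁻¹ * laplace p l = 1 := inv_mul_cancel₀ hL.ne'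
  exact le_antisymm
    (not_lt.1 fun h => ((hp.lt_rate_iff (inv_pos.2 hL) hl).1 h).ne' hroot)
    (not_lt.1 fun h => ((hp.rate_lt_iff (inv_pos.2 hL) hl).1 h).ne hroot)

theorem laplace_mul_sub_eq_of_eqOn_rate (hp : IsReturnFunction p) {x y A B : ℝ} (hx : 0 < x)
    (hxy : x < y) (haffine : EqOn (rate p) (fun κ => A * κ + B) (Ioo x y))
    (hl : 0 < l) (hxl : rate p x < l) (hly : l < rate p y) : laplace p l * (l - B) = A := by
  have hL := hp.laplace_pos hl
  have hxL : x < (laplace p l)⁻¹ := by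
    rw [← one_div, lt_div_iff₀ hL]
    exact (hp.rate_lt_iff hx hl).1 hxl
  have hLy : (laplace p l)⁻¹ < y :=
    (inv_lt_iff_one_lt_mul₀ hL).2 ((hp.lt_rate_iff (hx.trans hxy) hl).1 hly)
  have h : l - B = A * (laplace p l)⁻¹ := by
    simpa only [hp.rate_inv_laplace hl, sub_eq_iff_eq_add] using haffine ⟨hxL, hLy⟩
  rw [h, mul_left_comm, mul_inv_cancel₀ hL.ne', mul_one]

theorem strictConvexOn_rate (hp : IsReturnFunction p) (hα : 0 < α) (hc : 0 < c)
    (htail : Tendsto (fun t => p t * t ^ α) atTop (𝓝 c))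
    (hconv : ConvexOn ℝ (Ioi (criticalValue p)) (rate p)) :
    StrictConvexOn ℝ (Ioi (criticalValue p)) (rate p) := by
  refine strictConvexOn_of_not_eqOn_affine hconv fun x hx y _ hxy A B haffine =>
    hp.not_forall_laplace_mul_add_eq hα hc htail (-B) A ?_
  have hL := hp.laplaceIntegrable.analyticOnNhd_laplace hp.measurable hp.nonneg
  obtain ⟨l₀, hl₀⟩ := exists_between (hp.rate_lt_rate hx hxy)
  refine AnalyticOnNhd.eqOn_of_preconnected_of_eventuallyEq
    (fun l hl => (hL l hl).mul (analyticAt_id.add analyticAt_const))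
    (fun l _ => analyticAt_const) isPreconnected_Ioi ((hp.rate_pos hx).trans hl₀.1) ?_
  filter_upwards [Ioo_mem_nhds hl₀.1 hl₀.2] with l hl
  rw [← sub_eq_add_neg]
  exact hp.laplace_mul_sub_eq_of_eqOn_rate (pos_of_criticalValue_lt hx) hxy haffine
    ((hp.rate_pos hx).trans hl.1) hl.1 hl.2

end StrictConvexity

end IsReturnFunction

section Renewal

variable {f g h k m w : ℝ → ℝ≥0∞}

theorem lconvolution_add (hf : Measurable f) (hg : Measurable g) :
    f ⋆ₗ (g + h) = f ⋆ₗ g + f ⋆ₗ h := by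
  ext t
  simp only [lconvolution_def, Pi.add_apply, mul_add]
  exact lintegral_add_left (by fun_prop) _

theorem exp_mul_lconvolution (hf : Measurable f) (hg : Measurable g) (l t : ℝ) :
    ENNReal.ofReal (Real.exp (-(l * t))) * (f ⋆ₗ g) t =
      ((fun s => ENNReal.ofReal (Real.exp (-(l * s))) * f s) ⋆ₗ
        fun s => ENNReal.ofReal (Real.exp (-(l * s))) * g s) t := by
  rw [lconvolution_def, ← lintegral_const_mul _ (by fun_prop)]
  refine lintegral_congr fun s => ?_
  have hexp : Real.exp (-(l * t)) = Real.exp (-(l * s)) * Real.exp (-(l * (-s + t))) := by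
    rw [← Real.exp_add]
    ring_nf
  rw [hexp, ENNReal.ofReal_mul (Real.exp_nonneg _), mul_mul_mul_comm]

theorem lconvolution_indicator_Ici (f g : ℝ → ℝ≥0∞) (t : ℝ) :
    ((Ici 0).indicator f ⋆ₗ (Ici 0).indicator g) t = ∫⁻ s in Icc 0 t, f s * g (t - s) := by
  rw [lconvolution_def, ← lintegral_indicator measurableSet_Icc]
  refine lintegral_congr fun s => ?_
  rw [neg_add_eq_sub]
  by_cases hs : 0 ≤ s <;> by_cases hst : s ≤ t <;> simp [indicator, hs, hst]

theorem add_lconvolution_eq_of_resolvent (hf : Measurable f) (hk : Measurable k)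
    (hw : Measurable w) (hres : w = k + k ⋆ₗ w) :
    f + f ⋆ₗ w = f + k ⋆ₗ (f + f ⋆ₗ w) := by
  have hconv : f ⋆ₗ w = k ⋆ₗ f + k ⋆ₗ (f ⋆ₗ w) := by
    conv_lhs => rw [hres]
    rw [lconvolution_add hf hk, lconvolution_comm (f := f) (g := k),
      lconvolution_assoc hf hk hw, lconvolution_assoc hk hf hw,
      lconvolution_comm (f := f) (g := k)]
  rw [lconvolution_add hk hf, ← hconv]

theorem le_of_eq_add_lconvolution {b : ℝ≥0∞} {t : ℝ} (hm : m = f + k ⋆ₗ m)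
    (hf : ∀ s, f s ≤ 1) (hk : ∀ s < 0, k s = 0) (hb : b ≠ ⊤) (hmb : ∀ s ≤ t, m s ≤ b) :
    m t ≤ (1 - ∫⁻ s, k s)⁻¹ := by
  set sup : ℝ≥0∞ := ⨆ s : Iic t, m s
  have hsup : ∀ s ≤ t, m s ≤ sup := fun s hs => le_iSup (fun s : Iic t => m s) ⟨s, hs⟩
  have hsup_top : sup ≠ ⊤ := ne_top_of_le_ne_top hb (iSup_le fun s : Iic t => hmb s s.2)
  have hsup_le : sup ≤ 1 + sup * ∫⁻ s, k s := by
    refine iSup_le fun ⟨s, hs⟩ => ?_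
    rw [hm, ← lintegral_const_mul' _ _ hsup_top]
    refine add_le_add (hf s) (lintegral_mono fun v => ?_)
    rcases lt_or_ge v 0 with hv | hv
    · simp [hk v hv]
    · rw [mul_comm]
      exact mul_le_mul_left (hsup _ (by linarith [mem_Iic.1 hs])) _
  refine (hsup t le_rfl).trans (ENNReal.le_inv_iff_mul_le.2 ?_)
  rw [ENNReal.mul_sub fun _ _ => hsup_top, mul_one]
  exact tsub_le_iff_right.2 hsup_le

theorem exists_lintegral_Iic_gt {c : ℝ≥0∞} (hk : Measurable k) (hc : c < ∫⁻ s, k s) :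
    ∃ T : ℝ, 0 ≤ T ∧ c < ∫⁻ s in Iic T, k s :=
  ((eventually_ge_atTop 0).and (((aecover_Iic tendsto_id).lintegral_tendsto_of_countably_generated
    hk.aemeasurable).eventually (lt_mem_nhds hc))).exists

theorem exists_le_of_eq_add_lconvolution (hk_meas : Measurable k) (hm : m = f + k ⋆ₗ m)
    (hf : AntitoneOn f (Ici 0)) (hf_ne : ∀ s, 0 ≤ s → f s ≠ 0) (hk : ∀ s < 0, k s = 0)
    (hk_gt : 1 < ∫⁻ s, k s) (hm_zero : m 0 ≠ ⊤) :
    ∃ T, 0 ≤ T ∧ ∀ t, 0 ≤ t → f T ≤ m t := by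
  obtain ⟨T, hT₀, hT⟩ := exists_lintegral_Iic_gt hk_meas hk_gt
  refine ⟨T, hT₀, fun t ht => ?_⟩
  have hfm : f ≤ m := hm ▸ le_self_add
  set inf : ℝ≥0∞ := ⨅ s : Icc 0 t, m s
  have hinf : ∀ s ∈ Icc 0 t, inf ≤ m s := fun s hs => iInf_le (fun s : Icc 0 t => m s) ⟨s, hs⟩
  have hinf_zero : inf ≠ 0 := fun h => hf_ne t ht <| le_zero_iff.1 <| h ▸ le_iInf fun s =>
    (hf s.2.1 ht s.2.2).trans (hfm s)
  have hinf_top : inf ≠ ⊤ := ne_top_of_le_ne_top hm_zero (hinf 0 ⟨le_rfl, ht⟩)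
  have hlt : inf < inf * ∫⁻ s in Iic T, k s := by
    simpa only [mul_one] using (ENNReal.mul_lt_mul_iff_right hinf_zero hinf_top).2 hT
  have hle : min (f T) (inf * ∫⁻ s in Iic T, k s) ≤ inf := by
    refine le_iInf fun ⟨s, hs⟩ => ?_
    rcases le_or_gt s T with hsT | hsT
    · exact (min_le_left _ _).trans ((hf hs.1 (hs.1.trans hsT) hsT).trans (hfm s))
    · refine (min_le_right _ _).trans ?_
      rw [hm, ← lintegral_const_mul' _ _ hinf_top]
      refine le_add_left ((setLIntegral_mono' measurableSet_Iic fun v (hv : v ≤ T) => ?_).trans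
        (setLIntegral_le_lintegral (Iic T) _))
      rcases lt_or_ge v 0 with hv₀ | hv₀
      · simp [hk v hv₀]
      · rw [mul_comm]
        exact mul_le_mul_right (hinf _ ⟨by linarith, by linarith [hs.2]⟩) _
  exact ((min_le_iff.1 hle).resolve_right hlt.not_ge).trans (hinf t ⟨ht, le_rfl⟩)

end Renewal

theorem tendsto_one_div_mul_log_of_exp_bounds {N : ℝ → ℝ} {r : ℝ}
    (hone : ∀ t, 0 ≤ t → 1 ≤ N t)
    (hlower : ∀ l, 0 < l → l < r → ∃ c > 0, ∀ t, 0 ≤ t → c * Real.exp (l * t) ≤ N t)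
    (hupper : ∀ l, r < l → ∃ c > 0, ∀ t, 0 ≤ t → N t ≤ c * Real.exp (l * t)) :
    Tendsto (fun t : ℝ => (1 / t) * Real.log (N t)) atTop (𝓝 r) := by
  have hlim : ∀ c l : ℝ, Tendsto (fun t : ℝ => Real.log c / t + l) atTop (𝓝 l) := fun c l => by
    simpa using (tendsto_const_nhds.div_atTop tendsto_id).add_const l
  have hlog : ∀ {c l t : ℝ}, 0 < c → 0 < t →
      (1 / t) * Real.log (c * Real.exp (l * t)) = Real.log c / t + l := fun hc ht => by
    rw [Real.log_mul hc.ne' (Real.exp_pos _).ne', Real.log_exp]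
    field_simp
  refine tendsto_order.2 ⟨fun x hx => ?_, fun x hx => ?_⟩
  · rcases lt_or_ge x 0 with hx₀ | hx₀
    · filter_upwards [eventually_gt_atTop 0] with t ht
      exact hx₀.trans_le (mul_nonneg (by positivity) (Real.log_nonneg (hone t ht.le)))
    · obtain ⟨l, hxl, hlr⟩ := exists_between hx
      obtain ⟨c, hc, hcN⟩ := hlower l (hx₀.trans_lt hxl) hlr
      filter_upwards [eventually_gt_atTop 0, (hlim c l).eventually (lt_mem_nhds hxl)]
        with t ht hxt
      rw [← hlog hc ht] at hxt
      have hcNt := hcN t ht.le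
      exact hxt.trans_le (by gcongr)
  · obtain ⟨l, hrl, hlx⟩ := exists_between hx
    obtain ⟨c, hc, hcN⟩ := hupper l hrl
    filter_upwards [eventually_gt_atTop 0, (hlim c l).eventually (gt_mem_nhds hlx)] with t ht hxt
    rw [← hlog hc ht] at hxt
    have hNt := hone t ht.le
    have hcNt := hcN t ht.le
    exact lt_of_le_of_lt (by gcongr) hxt

section Tilt

variable {l : ℝ}

/-- The function `t ↦ exp (-l t) f(t)` on `[0, ∞)`, extended by zero to the real line. -/
def tilt (l : ℝ) (f : ℝ → ℝ) (t : ℝ) : ℝ≥0∞ :=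
  ENNReal.ofReal (Real.exp (-(l * t))) * (Ici 0).indicator (fun s => ENNReal.ofReal (f s)) t

theorem tilt_of_nonneg (f : ℝ → ℝ) {t : ℝ} (ht : 0 ≤ t) :
    tilt l f t = ENNReal.ofReal (Real.exp (-(l * t)) * f t) := by
  rw [tilt, indicator_of_mem (mem_Ici.2 ht), ENNReal.ofReal_mul (Real.exp_nonneg _)]

theorem tilt_of_neg (f : ℝ → ℝ) {t : ℝ} (ht : t < 0) : tilt l f t = 0 := by
  rw [tilt, indicator_of_notMem (notMem_Ici.2 ht), mul_zero]

theorem measurable_tilt {f : ℝ → ℝ} (hf : Measurable f) : Measurable (tilt l f) := by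
  have hind := hf.ennreal_ofReal.indicator (measurableSet_Ici (a := 0))
  unfold tilt
  fun_prop

theorem tilt_one_le (hl : 0 ≤ l) (t : ℝ) : tilt l 1 t ≤ 1 := by
  rcases lt_or_ge t 0 with ht | ht
  · simp [tilt_of_neg 1 ht]
  · rw [tilt_of_nonneg 1 ht, Pi.one_apply, mul_one, ENNReal.ofReal_le_one, Real.exp_le_one_iff]
    nlinarith

theorem antitoneOn_tilt_one (hl : 0 ≤ l) : AntitoneOn (tilt l 1) (Ici 0) := fun s hs t ht hst => by
  simp only [tilt_of_nonneg 1 hs, tilt_of_nonneg 1 ht, Pi.one_apply, mul_one]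
  gcongr

theorem IsReturnFunction.lintegral_tilt {p : ℝ → ℝ} (hp : IsReturnFunction p) {κ : ℝ}
    (hκ : 0 < κ) (hl : 0 < l) :
    ∫⁻ s, tilt l (fun s => κ * p s) s = ENNReal.ofReal (κ * laplace p l) := by
  rw [ENNReal.ofReal_mul hκ.le, hp.ofReal_laplace hl, restrict_Ioi_eq_restrict_Ici,
    ← lintegral_const_mul' _ _ ENNReal.ofReal_ne_top, ← lintegral_indicator measurableSet_Ici]
  refine lintegral_congr fun t => ?_
  by_cases ht : 0 ≤ t
  · rw [tilt_of_nonneg _ ht, indicator_of_mem (mem_Ici.2 ht), ← ENNReal.ofReal_mul hκ.le,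
      mul_left_comm]
  · rw [tilt_of_neg _ (not_le.1 ht), indicator_of_notMem (mt mem_Ici.1 ht)]

end Tilt

/-- `N` is a locally bounded solution of the renewal equation `N = 1 + κ p ⋆ N` on `[0, ∞)`. The
equation is stated in `[0, ∞]`, so that no integrability has to be assumed. -/
structure IsRenewalSolution (p : ℝ → ℝ) (κ : ℝ) (N : ℝ → ℝ) : Prop where
  measurable : Measurable N
  bddAbove : ∀ t, BddAbove (N '' Icc 0 t)
  renewal : ∀ t, 0 ≤ t → ENNReal.ofReal (N t) =
    1 + ∫⁻ s in Icc 0 t, ENNReal.ofReal (κ * p s) * ENNReal.ofReal (N (t - s))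

namespace IsRenewalSolution

variable {p N : ℝ → ℝ} {κ l : ℝ}

theorem one_le (hN : IsRenewalSolution p κ N) {t : ℝ} (ht : 0 ≤ t) : 1 ≤ N t := by
  rw [← ENNReal.one_le_ofReal, hN.renewal t ht]
  exact le_self_add

theorem tilt_eq (hN : IsRenewalSolution p κ N) (hp : Measurable p) (l : ℝ) :
    tilt l N = tilt l 1 + tilt l (fun s => κ * p s) ⋆ₗ tilt l N := by
  have hk : Measurable fun s => ENNReal.ofReal (κ * p s) := by fun_prop
  ext t
  have hconv := exp_mul_lconvolution (hk.indicator (measurableSet_Ici (a := 0)))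
    (hN.measurable.ennreal_ofReal.indicator (measurableSet_Ici (a := 0))) l t
  rw [Pi.add_apply, show (tilt l (fun s => κ * p s) ⋆ₗ tilt l N) t = _ from hconv.symm,
    lconvolution_indicator_Ici, tilt, tilt, ← mul_add]
  rcases lt_or_ge t 0 with ht | ht
  · simp [ht]
  · simp [ht, hN.renewal t ht]

theorem exists_le_mul_exp (hN : IsRenewalSolution p κ N) (hp : IsReturnFunction p) (hκ : 0 < κ)
    (hl : rate p κ < l) : ∃ c > 0, ∀ t, 0 ≤ t → N t ≤ c * Real.exp (l * t) := by
  have hl₀ : 0 < l := (rate_nonneg p κ).trans_lt hl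
  have hlt : κ * laplace p l < 1 := (hp.rate_lt_iff hκ hl₀).1 hl
  refine ⟨(1 - κ * laplace p l)⁻¹, inv_pos.2 (sub_pos.2 hlt), fun t ht => ?_⟩
  obtain ⟨b, hb⟩ := hN.bddAbove t
  have hbound : ∀ s ≤ t, tilt l N s ≤ ENNReal.ofReal b := fun s hst => by
    rcases lt_or_ge s 0 with hs | hs
    · simp [tilt_of_neg N hs]
    · rw [tilt_of_nonneg N hs]
      refine ENNReal.ofReal_le_ofReal (le_trans ?_ (hb ⟨s, ⟨hs, hst⟩, rfl⟩))
      exact mul_le_of_le_one_left (zero_le_one.trans (hN.one_le hs))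
        (Real.exp_le_one_iff.2 (by nlinarith))
  have hle := le_of_eq_add_lconvolution (hN.tilt_eq hp.measurable l) (tilt_one_le hl₀.le)
    (fun _ hs => tilt_of_neg _ hs) ENNReal.ofReal_ne_top hbound
  rw [hp.lintegral_tilt hκ hl₀, tilt_of_nonneg N ht, ← ENNReal.ofReal_one,
    ← ENNReal.ofReal_sub 1 (mul_nonneg hκ.le (hp.laplace_pos hl₀).le),
    ← ENNReal.ofReal_inv_of_pos (sub_pos.2 hlt),
    ENNReal.ofReal_le_ofReal_iff (inv_nonneg.2 (sub_pos.2 hlt).le), Real.exp_neg,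
    inv_mul_le_iff₀ (Real.exp_pos _)] at hle
  rwa [mul_comm]

theorem exists_mul_exp_le (hN : IsRenewalSolution p κ N) (hp : IsReturnFunction p) (hκ : 0 < κ)
    (hl₀ : 0 < l) (hl : l < rate p κ) : ∃ c > 0, ∀ t, 0 ≤ t → c * Real.exp (l * t) ≤ N t := by
  have hgt : 1 < ∫⁻ s, tilt l (fun s => κ * p s) s := by
    rw [hp.lintegral_tilt hκ hl₀, ENNReal.one_lt_ofReal]
    exact (hp.lt_rate_iff hκ hl₀).1 hl
  obtain ⟨T, hT₀, hT⟩ := exists_le_of_eq_add_lconvolution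
    (measurable_tilt (hp.measurable.const_mul κ)) (hN.tilt_eq hp.measurable l)
    (antitoneOn_tilt_one hl₀.le) (fun s hs => by simp [tilt_of_nonneg 1 hs, Real.exp_pos])
    (fun _ hs => tilt_of_neg _ hs) hgt (by simp [tilt_of_nonneg])
  refine ⟨Real.exp (-(l * T)), Real.exp_pos _, fun t ht => ?_⟩
  have hle := hT t ht
  rwa [tilt_of_nonneg 1 hT₀, tilt_of_nonneg N ht, Pi.one_apply, mul_one,
    ENNReal.ofReal_le_ofReal_iff (mul_nonneg (Real.exp_nonneg _) (zero_le_one.trans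
      (hN.one_le ht))), Real.exp_neg (l * t), ← div_eq_inv_mul,
    le_div_iff₀ (Real.exp_pos _)] at hle

theorem tendsto_one_div_mul_log (hN : IsRenewalSolution p κ N) (hp : IsReturnFunction p)
    (hκ : 0 < κ) : Tendsto (fun t : ℝ => (1 / t) * Real.log (N t)) atTop (𝓝 (rate p κ)) :=
  tendsto_one_div_mul_log_of_exp_bounds (fun _ ht => hN.one_le ht)
    (fun _ hl₀ hl => hN.exists_mul_exp_le hp hκ hl₀ hl)
    (fun _ hl => hN.exists_le_mul_exp hp hκ hl)

end IsRenewalSolution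

section RightContinuous

variable {Ω β : Type*} [MeasurableSpace Ω] [TopologicalSpace β]
  [TopologicalSpace.PseudoMetrizableSpace β] [MeasurableSpace β] [BorelSpace β]

theorem tendsto_ceil_mul_div_nhdsGE (s : ℝ) :
    Tendsto (fun n : ℕ => (⌈((n : ℝ) + 1) * s⌉ : ℝ) / (n + 1)) atTop (𝓝[≥] s) := by
  have hpos : ∀ n : ℕ, (0 : ℝ) < n + 1 := fun n => n.cast_add_one_pos
  have hge : ∀ n : ℕ, s ≤ (⌈((n : ℝ) + 1) * s⌉ : ℝ) / (n + 1) := fun n => by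
    rw [le_div_iff₀' (hpos n)]
    exact Int.le_ceil _
  refine tendsto_nhdsWithin_iff.2 ⟨?_, .of_forall hge⟩
  refine tendsto_of_tendsto_of_tendsto_of_le_of_le tendsto_const_nhds
    (by simpa using (tendsto_one_div_add_atTop_nhds_zero_nat (𝕜 := ℝ)).const_add s) hge fun n => ?_
  rw [div_le_iff₀' (hpos n), mul_add, mul_inv_cancel₀ (hpos n).ne']
  exact (Int.ceil_lt_add_one _).le

theorem measurable_uncurry_of_continuousWithinAt_Ici {f : ℝ → Ω → β} (hf : ∀ t, Measurable (f t))
    (hcont : ∀ ω t, ContinuousWithinAt (fun s => f s ω) (Ici t) t) :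
    Measurable (Function.uncurry f) := by
  refine measurable_of_tendsto_metrizable
    (f := fun (n : ℕ) q => f (⌈((n : ℝ) + 1) * q.1⌉ / (n + 1)) q.2) (fun n => ?_)
    (tendsto_pi_nhds.2 fun ⟨s, ω⟩ => ?_)
  · have hgrid : Measurable fun q : ℤ × Ω => f (q.1 / (n + 1)) q.2 :=
      measurable_from_prod_countable_right fun k => hf (k / (n + 1))
    exact hgrid.comp (by fun_prop : Measurable fun q : ℝ × Ω => (⌈((n : ℝ) + 1) * q.1⌉, q.2))
  · exact (hcont ω s).tendsto.comp (tendsto_ceil_mul_div_nhdsGE s)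

theorem measurable_of_continuousWithinAt_Ici {f : ℝ → β}
    (hf : ∀ t, ContinuousWithinAt f (Ici t) t) : Measurable f :=
  (measurable_uncurry_of_continuousWithinAt_Ici (f := fun t (_ : Unit) => f t)
    (fun _ => measurable_const) fun _ => hf).comp (measurable_prodMk_right (y := ()))

end RightContinuous

theorem exp_intervalIntegral_eq {f : ℝ → ℝ} (hf : ∀ t, ContinuousWithinAt f (Ici t) t)
    (hint : ∀ a b, IntervalIntegrable f volume a b) {t : ℝ} (ht : 0 ≤ t) :
    Real.exp (∫ s in 0..t, f s) = 1 + ∫ s in 0..t, Real.exp (∫ u in 0..s, f u) * f s := by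
  have hcont : Continuous fun s => ∫ u in 0..s, f u := intervalIntegral.continuous_primitive hint 0
  have hderiv : ∀ s, HasDerivWithinAt (fun s => ∫ u in 0..s, f u) (f s) (Ioi s) s := fun s =>
    (intervalIntegral.integral_hasDerivWithinAt_right (s := Ici s) (t := Ioi s) (hint 0 s)
      (measurable_of_continuousWithinAt_Ici hf).stronglyMeasurable.stronglyMeasurableAtFilter
      ((hf s).mono Ioi_subset_Ici_self)).mono Ioi_subset_Ici_self
  rw [intervalIntegral.integral_eq_sub_of_hasDeriv_right_of_le ht (by fun_prop)
    (fun s _ => (hderiv s).exp) ((hint 0 t).continuousOn_mul (by fun_prop)),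
    intervalIntegral.integral_same, Real.exp_zero, add_sub_cancel]

section Occupation

variable {S Ω : Type*} {X : ℝ≥0 → Ω → S} {i : S} {ω : Ω} {κ t : ℝ}

/-- The event `X_t = i`, with real time `t`; negative times are identified with time `0`. -/
def visit (X : ℝ≥0 → Ω → S) (i : S) (t : ℝ) : Set Ω :=
  {ω | X t.toNNReal ω = i}

/-- `exp (κ L_t)` for the local time `L_t` in `i`, as a function of the real time `t` with values
in `[0, ∞]`. -/
def expLocalTime (X : ℝ≥0 → Ω → S) (i : S) (κ t : ℝ) (ω : Ω) : ℝ≥0∞ :=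
  ENNReal.ofReal (Real.exp (κ * localTime X i t.toNNReal ω))

theorem localTime_eq_integral_visit (X : ℝ≥0 → Ω → S) (i : S) (t : ℝ≥0) (ω : Ω) :
    localTime X i t ω = ∫ s in (0 : ℝ)..t, (visit X i s).indicator 1 ω :=
  rfl

theorem localTime_nonneg (X : ℝ≥0 → Ω → S) (i : S) (t : ℝ≥0) (ω : Ω) : 0 ≤ localTime X i t ω := by
  rw [localTime_eq_integral_visit]
  exact intervalIntegral.integral_nonneg t.coe_nonneg fun s _ => indicator_nonneg (by simp) ω

theorem continuousWithinAt_indicator_visit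
    (hω : ∀ t, ∀ᶠ s in 𝓝[≥] t, (X s ω = i ↔ X t ω = i)) (t : ℝ) :
    ContinuousWithinAt (fun s => (visit X i s).indicator (1 : Ω → ℝ) ω) (Ici t) t := by
  have htoNNReal : Tendsto Real.toNNReal (𝓝[≥] t) (𝓝[≥] t.toNNReal) :=
    continuous_real_toNNReal.continuousWithinAt.tendsto_nhdsWithin fun s hs =>
      Real.toNNReal_le_toNNReal hs
  refine tendsto_const_nhds.congr' ?_
  filter_upwards [htoNNReal.eventually (hω t.toNNReal)] with s hs
  exact indicator_eq_indicator (α := Ω) hs.symm rfl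

theorem intervalIntegrable_indicator_visit
    (hω : ∀ t, ∀ᶠ s in 𝓝[≥] t, (X s ω = i ↔ X t ω = i)) (a b : ℝ) :
    IntervalIntegrable (fun s => (visit X i s).indicator (1 : Ω → ℝ) ω) volume a b := by
  refine (intervalIntegrable_const (c := (1 : ℝ))).mono_fun (measurable_of_continuousWithinAt_Ici
    (continuousWithinAt_indicator_visit hω)).aestronglyMeasurable (ae_of_all _ fun s => ?_)
  exact (norm_indicator_le_norm_self _ _).trans (by simp)

theorem localTime_le (hω : ∀ t, ∀ᶠ s in 𝓝[≥] t, (X s ω = i ↔ X t ω = i)) (t : ℝ≥0) :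
    localTime X i t ω ≤ t := by
  rw [localTime_eq_integral_visit]
  have hle := intervalIntegral.integral_mono_on t.coe_nonneg
    (intervalIntegrable_indicator_visit hω 0 t) (intervalIntegrable_const (c := (1 : ℝ)))
    fun s _ => indicator_le_self' (fun _ _ => zero_le_one) ω
  simpa using hle

theorem continuous_localTime_toNNReal (hω : ∀ t, ∀ᶠ s in 𝓝[≥] t, (X s ω = i ↔ X t ω = i)) :
    Continuous fun t : ℝ => localTime X i t.toNNReal ω :=
  (intervalIntegral.continuous_primitive (intervalIntegrable_indicator_visit hω) 0).comp
    (NNReal.continuous_coe.comp continuous_real_toNNReal)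

theorem expLocalTime_eq (hω : ∀ t, ∀ᶠ s in 𝓝[≥] t, (X s ω = i ↔ X t ω = i)) (hκ : 0 ≤ κ)
    (ht : 0 ≤ t) :
    expLocalTime X i κ t ω = 1 + ∫⁻ s in Icc 0 t,
      ENNReal.ofReal κ * (visit X i s).indicator (expLocalTime X i κ s) ω := by
  have hint := fun a b => (intervalIntegrable_indicator_visit hω a b).const_mul κ
  have hlocalTime : ∀ s, 0 ≤ s →
      ∫ u in 0..s, κ * (visit X i u).indicator 1 ω = κ * localTime X i s.toNNReal ω :=
    fun s hs => by
      rw [intervalIntegral.integral_const_mul, localTime_eq_integral_visit, Real.coe_toNNReal s hs]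
  have hnonneg : ∀ s, 0 ≤ Real.exp (∫ u in 0..s, κ * (visit X i u).indicator 1 ω) *
      (κ * (visit X i s).indicator 1 ω) := fun s =>
    mul_nonneg (Real.exp_nonneg _) (mul_nonneg hκ (indicator_nonneg (by simp) ω))
  have hcont : Continuous fun s => ∫ u in 0..s, κ * (visit X i u).indicator 1 ω :=
    intervalIntegral.continuous_primitive hint 0
  rw [expLocalTime, ← hlocalTime t ht, exp_intervalIntegral_eq
    (fun s => (continuousWithinAt_indicator_visit hω s).const_mul κ) hint ht,
    intervalIntegral.integral_of_le ht, ← integral_Icc_eq_integral_Ioc,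
    ENNReal.ofReal_add zero_le_one (integral_nonneg hnonneg), ENNReal.ofReal_one,
    ofReal_integral_eq_lintegral_ofReal ((intervalIntegrable_iff_integrableOn_Icc_of_le ht).1
      ((hint 0 t).continuousOn_mul hcont.rexp.continuousOn)) (ae_of_all _ hnonneg)]
  congr 1
  refine setLIntegral_congr_fun measurableSet_Icc fun s hs => ?_
  rw [hlocalTime s hs.1, mul_comm, ENNReal.ofReal_mul' (Real.exp_nonneg _), ENNReal.ofReal_mul hκ,
    mul_assoc]
  by_cases hvisit : ω ∈ visit X i s <;> simp [hvisit, expLocalTime]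

variable [MeasurableSpace Ω]

theorem measurable_localTime {t : ℝ≥0} (hmeas : ∀ u ≤ t, MeasurableSet {ω | X u ω = i})
    (hcont : ∀ ω t, ∀ᶠ s in 𝓝[≥] t, (X s ω = i ↔ X t ω = i)) : Measurable (localTime X i t) := by
  have hstopped : Measurable (Function.uncurry fun (s : ℝ) ω =>
      (visit X i (min s t)).indicator (1 : Ω → ℝ) ω) := by
    refine measurable_uncurry_of_continuousWithinAt_Ici (fun s => measurable_const.indicator
      (hmeas _ (Real.toNNReal_le_iff_le_coe.2 (min_le_right _ _)))) fun ω s => ?_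
    exact (continuousWithinAt_indicator_visit (hcont ω) (min s t)).comp (f := fun u : ℝ => min u t)
      (by fun_prop : Continuous fun u : ℝ => min u t).continuousWithinAt
      fun u hu => mem_Ici.2 (min_le_min_right _ (mem_Ici.1 hu))
  convert ((hstopped.comp measurable_swap).stronglyMeasurable.integral_prod_right'
    (ν := volume.restrict (Ioc (0 : ℝ) t))).measurable using 1
  ext ω
  rw [localTime_eq_integral_visit, intervalIntegral.integral_of_le t.coe_nonneg]
  refine setIntegral_congr_fun measurableSet_Ioc fun s hs => ?_
  simp [min_eq_left hs.2]

variable (hmeas : ∀ t, MeasurableSet {ω | X t ω = i})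
  (hcont : ∀ ω t, ∀ᶠ s in 𝓝[≥] t, (X s ω = i ↔ X t ω = i))

include hmeas hcont

theorem measurableSet_mem_visit : MeasurableSet {q : ℝ × Ω | q.2 ∈ visit X i q.1} := by
  have hind := measurable_uncurry_of_continuousWithinAt_Ici
    (f := fun s ω => (visit X i s).indicator (1 : Ω → ℝ) ω)
    (fun s => measurable_const.indicator (hmeas _))
    fun ω => continuousWithinAt_indicator_visit (hcont ω)
  convert hind (measurableSet_singleton 1) using 1
  ext q
  by_cases hq : q.2 ∈ visit X i q.1 <;> simp [Function.uncurry, hq]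

theorem measurable_uncurry_localTime :
    Measurable (Function.uncurry fun (t : ℝ) ω => localTime X i t.toNNReal ω) :=
  measurable_uncurry_of_continuousWithinAt_Ici
    (fun _ => measurable_localTime (fun u _ => hmeas u) hcont)
    fun ω _ => (continuous_localTime_toNNReal (hcont ω)).continuousWithinAt

theorem measurable_indicator_expLocalTime (κ : ℝ) :
    Measurable fun q : ℝ × Ω => (visit X i q.1).indicator (expLocalTime X i κ q.1) q.2 :=
  (((measurable_uncurry_localTime hmeas hcont).const_mul κ).exp.ennreal_ofReal).indicator
    (measurableSet_mem_visit hmeas hcont)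

theorem integrable_exp_mul_localTime (ν : Measure Ω) [IsFiniteMeasure ν] (κ : ℝ) (t : ℝ≥0) :
    Integrable (fun ω => Real.exp (κ * localTime X i t ω)) ν := by
  have hlocalTime := measurable_localTime (t := t) (fun u _ => hmeas u) hcont
  refine Integrable.of_bound (C := Real.exp (|κ| * t)) (by fun_prop) (ae_of_all _ fun ω => ?_)
  rw [Real.norm_eq_abs, Real.abs_exp]
  gcongr
  · exact localTime_nonneg X i t ω
  · exact le_abs_self κ
  · exact localTime_le (hcont ω) t

theorem lintegral_expLocalTime (ν : Measure Ω) [SFinite ν] (hκ : 0 ≤ κ) (ht : 0 ≤ t) :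
    ∫⁻ ω, expLocalTime X i κ t ω ∂ν = ν univ + ∫⁻ s in Icc 0 t,
      ENNReal.ofReal κ * ∫⁻ ω in visit X i s, expLocalTime X i κ s ω ∂ν := by
  have hind := measurable_indicator_expLocalTime hmeas hcont κ
  rw [lintegral_congr fun ω => expLocalTime_eq (hcont ω) hκ ht, lintegral_add_left measurable_const,
    lintegral_const, one_mul, lintegral_lintegral_swap
      ((hind.comp measurable_swap).const_mul _).aemeasurable]
  congr 1
  refine lintegral_congr fun s => ?_
  rw [lintegral_const_mul' _ _ ENNReal.ofReal_ne_top, lintegral_indicator]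
  exact hmeas _

end Occupation

theorem convexOn_cgf {Ω : Type*} [MeasurableSpace Ω] {μ : Measure Ω} {X : Ω → ℝ} :
    ConvexOn ℝ (interior (ProbabilityTheory.integrableExpSet X μ)) (ProbabilityTheory.cgf X μ) := by
  refine convexOn_of_deriv2_nonneg' ProbabilityTheory.convex_integrableExpSet.interior
    ProbabilityTheory.analyticOnNhd_cgf.differentiableOn
    ProbabilityTheory.analyticOnNhd_cgf.deriv.differentiableOn fun κ hκ => ?_
  rw [← iteratedDeriv_eq_iterate, ← ProbabilityTheory.variance_tilted_mul hκ]
  exact ProbabilityTheory.variance_nonneg _ _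

section RegenerativeState

variable {S Ω : Type*}

/-- The `σ`-algebra generated by the visits of `X` to `i` up to time `t`. -/
abbrev visitPast (X : ℝ≥0 → Ω → S) (i : S) (t : ℝ≥0) : MeasurableSpace Ω :=
  ⨆ u : Iic t, MeasurableSpace.generateFrom {{ω | X u ω = i}}

/-- Under the law `μ`, the process `X` starts in `i` and regenerates whenever it is in `i`: the
set of times at which `X` visits `i` is a standard regenerative phenomenon in the sense of Kingman
(with right-continuous indicator). -/
structure IsRegenerativeState [MeasurableSpace Ω] (μ : Measure Ω) (X : ℝ≥0 → Ω → S) (i : S) :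
    Prop where
  isProbabilityMeasure : IsProbabilityMeasure μ
  measurableSet : ∀ t, MeasurableSet {ω | X t ω = i}
  right_continuous : ∀ ω t, ∀ᶠ s in 𝓝[≥] t, (X s ω = i ↔ X t ω = i)
  start : ∀ᵐ ω ∂μ, X 0 ω = i
  regenerative : ∀ (s t : ℝ≥0) (A : Set Ω), MeasurableSet[visitPast X i s] A →
    μ (A ∩ {ω | X s ω = i} ∩ {ω | X (s + t) ω = i}) =
      μ (A ∩ {ω | X s ω = i}) * μ {ω | X t ω = i}

variable {X : ℝ≥0 → Ω → S} {i : S}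

theorem measurableSet_visitPast {u t : ℝ≥0} (hut : u ≤ t) :
    MeasurableSet[visitPast X i t] {ω | X u ω = i} :=
  le_iSup (fun u : Iic t => MeasurableSpace.generateFrom {{ω | X u ω = i}}) ⟨u, hut⟩ _
    (MeasurableSpace.measurableSet_generateFrom rfl)

theorem visitPast_le_iSup_comap [MeasurableSpace S] [MeasurableSingletonClass S] (X : ℝ≥0 → Ω → S)
    (i : S) (t : ℝ≥0) : visitPast X i t ≤ ⨆ u : Iic t, MeasurableSpace.comap (X u) inferInstance :=
  iSup_mono fun _ => MeasurableSpace.generateFrom_le fun _ hA =>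
    mem_singleton_iff.1 hA ▸ ⟨{i}, measurableSet_singleton i, rfl⟩

variable [MeasurableSpace Ω]

theorem IsMarkovProcess.isRegenerativeState [MeasurableSpace S] [MeasurableSingletonClass S]
    {a : S → S → ℝ} {P : S → Measure Ω} (hX : IsMarkovProcess a P X) (i : S) :
    IsRegenerativeState (P i) X i where
  isProbabilityMeasure := hX.isProbabilityMeasure i
  measurableSet t := hX.measurable t (measurableSet_singleton i)
  right_continuous ω t := (hX.right_continuous ω t).mono fun s hs => by rw [hs]
  start := hX.start i
  regenerative s t A hA := hX.markov s t A (visitPast_le_iSup_comap X i s A hA) i i i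

/-- The expectation of `exp (κ L_t)` on the event `X_t = i`. -/
def visitMoment (μ : Measure Ω) (X : ℝ≥0 → Ω → S) (i : S) (κ t : ℝ) : ℝ≥0∞ :=
  ∫⁻ ω in visit X i t, expLocalTime X i κ t ω ∂μ

namespace IsRegenerativeState

variable {μ : Measure Ω} {κ t : ℝ}

theorem measurableSet_visit (hX : IsRegenerativeState μ X i) (t : ℝ) :
    MeasurableSet (visit X i t) :=
  hX.measurableSet t.toNNReal

theorem visitPast_le (hX : IsRegenerativeState μ X i) (t : ℝ≥0) : visitPast X i t ≤ ‹_› :=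
  iSup_le fun u => MeasurableSpace.generateFrom_le fun _ hA =>
    mem_singleton_iff.1 hA ▸ hX.measurableSet u

theorem setLIntegral_inter_visit (hX : IsRegenerativeState μ X i) (s t : ℝ≥0) {Z : Ω → ℝ≥0∞}
    (hZ : Measurable[visitPast X i s] Z) :
    ∫⁻ ω in {ω | X s ω = i} ∩ {ω | X (s + t) ω = i}, Z ω ∂μ =
      (∫⁻ ω in {ω | X s ω = i}, Z ω ∂μ) * μ {ω | X t ω = i} := by
  have hle := hX.visitPast_le s
  rw [← lintegral_trim hle hZ, ← lintegral_trim hle hZ, mul_comm, ← smul_eq_mul,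
    ← lintegral_smul_measure]
  congr 1
  refine @Measure.ext Ω (visitPast X i s) _ _ fun A hA => ?_
  rw [trim_measurableSet_eq hle hA, Measure.smul_apply, trim_measurableSet_eq hle hA,
    Measure.restrict_apply (hle A hA), Measure.restrict_apply (hle A hA), ← inter_assoc,
    hX.regenerative s t A hA, smul_eq_mul, mul_comm]

theorem isReturnFunction (hX : IsRegenerativeState μ X i) :
    IsReturnFunction fun t => μ.real (visit X i t) where
  measurable := by
    have := hX.isProbabilityMeasure
    exact (measurable_measure_prodMk_left
      (measurableSet_mem_visit hX.measurableSet hX.right_continuous)).ennreal_toReal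
  nonneg _ := measureReal_nonneg
  le_one _ := by
    have := hX.isProbabilityMeasure
    exact measureReal_le_one
  tendsto_one := by
    have := hX.isProbabilityMeasure
    have hlim : ∀ᵐ ω ∂μ, ∀ᶠ t in 𝓝[>] (0 : ℝ), (ω ∈ visit X i t ↔ ω ∈ univ) := by
      filter_upwards [hX.start] with ω hω
      have htoNNReal : Tendsto Real.toNNReal (𝓝[>] 0) (𝓝[≥] 0) :=
        tendsto_nhdsWithin_iff.2 ⟨(continuous_real_toNNReal.tendsto' 0 0
          Real.toNNReal_zero).mono_left nhdsWithin_le_nhds, .of_forall fun _ => mem_Ici.2 zero_le⟩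
      filter_upwards [htoNNReal.eventually (hX.right_continuous ω 0)] with t ht
      exact iff_of_true (ht.2 hω) trivial
    simpa using! (ENNReal.tendsto_toReal (measure_ne_top μ univ)).comp
      (tendsto_measure_of_ae_tendsto_indicator_of_isFiniteMeasure _ MeasurableSet.univ
        hX.measurableSet_visit hlim)

theorem measurable_expLocalTime_visitPast (hX : IsRegenerativeState μ X i) (κ s : ℝ) :
    Measurable[visitPast X i s.toNNReal] (expLocalTime X i κ s) := by
  have hlocalTime : Measurable[visitPast X i s.toNNReal] (localTime X i s.toNNReal) :=
    @measurable_localTime S Ω X i (visitPast X i s.toNNReal) s.toNNReal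
      (fun _ hu => measurableSet_visitPast hu) hX.right_continuous
  exact ((hlocalTime.const_mul κ).exp).ennreal_ofReal

theorem ofReal_mgf_localTime (hX : IsRegenerativeState μ X i) (κ t : ℝ) :
    ENNReal.ofReal (ProbabilityTheory.mgf (localTime X i t.toNNReal) μ κ) =
      ∫⁻ ω, expLocalTime X i κ t ω ∂μ :=
  have := hX.isProbabilityMeasure
  ofReal_integral_eq_lintegral_ofReal
    (integrable_exp_mul_localTime hX.measurableSet hX.right_continuous μ κ _)
    (ae_of_all _ fun _ => Real.exp_nonneg _)

theorem measurable_visitMoment (hX : IsRegenerativeState μ X i) (κ : ℝ) :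
    Measurable (visitMoment μ X i κ) := by
  have := hX.isProbabilityMeasure
  have heq : visitMoment μ X i κ =
      fun s => ∫⁻ ω, (visit X i s).indicator (expLocalTime X i κ s) ω ∂μ :=
    funext fun s => (lintegral_indicator (hX.measurableSet_visit s) _).symm
  rw [heq]
  exact (measurable_indicator_expLocalTime hX.measurableSet hX.right_continuous
    κ).lintegral_prod_right'

theorem visitMoment_eq (hX : IsRegenerativeState μ X i) (hκ : 0 ≤ κ) (ht : 0 ≤ t) :
    visitMoment μ X i κ t = μ (visit X i t) + ∫⁻ s in Icc 0 t,
      ENNReal.ofReal κ * visitMoment μ X i κ s * μ (visit X i (t - s)) := by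
  have := hX.isProbabilityMeasure
  rw [visitMoment, lintegral_expLocalTime hX.measurableSet hX.right_continuous _ hκ ht,
    Measure.restrict_apply_univ]
  congr 1
  refine setLIntegral_congr_fun measurableSet_Icc fun s hs => ?_
  have hst : t.toNNReal = s.toNNReal + (t - s).toNNReal := by
    rw [← Real.toNNReal_add hs.1 (sub_nonneg.2 hs.2), add_sub_cancel]
  rw [Measure.restrict_restrict (hX.measurableSet_visit s), mul_assoc, visit, visit, hst,
    hX.setLIntegral_inter_visit _ _ (hX.measurable_expLocalTime_visitPast κ s)]
  rfl

theorem lintegral_expLocalTime_eq (hX : IsRegenerativeState μ X i) (hκ : 0 ≤ κ) (ht : 0 ≤ t) :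
    ∫⁻ ω, expLocalTime X i κ t ω ∂μ = 1 + ∫⁻ s in Icc 0 t, ENNReal.ofReal κ * μ (visit X i s) *
      ∫⁻ ω, expLocalTime X i κ (t - s) ω ∂μ := by
  have := hX.isProbabilityMeasure
  set f := (Ici 0).indicator (1 : ℝ → ℝ≥0∞)
  set k := (Ici 0).indicator fun s => ENNReal.ofReal κ * μ (visit X i s)
  set w := (Ici 0).indicator fun s => ENNReal.ofReal κ * visitMoment μ X i κ s
  set m := (Ici 0).indicator fun s => ∫⁻ ω, expLocalTime X i κ s ω ∂μ
  have hf : Measurable f := measurable_one.indicator measurableSet_Ici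
  have hk : Measurable k := ((measurable_measure_prodMk_left (measurableSet_mem_visit
    hX.measurableSet hX.right_continuous)).const_mul _).indicator measurableSet_Ici
  have hw : Measurable w := ((hX.measurable_visitMoment κ).const_mul _).indicator measurableSet_Ici
  have hres : w = k + k ⋆ₗ w := by
    rw [lconvolution_comm]
    ext s
    rw [Pi.add_apply, lconvolution_indicator_Ici]
    rcases lt_or_ge s 0 with hs | hs
    · simp [k, w, hs]
    · simp only [k, w, indicator_of_mem (mem_Ici.2 hs)]
      rw [hX.visitMoment_eq hκ hs, mul_add, ← lintegral_const_mul' _ _ ENNReal.ofReal_ne_top]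
      simp only [mul_assoc, mul_left_comm]
  have hm : m = f + f ⋆ₗ w := by
    rw [lconvolution_comm]
    ext s
    rw [Pi.add_apply, lconvolution_indicator_Ici]
    rcases lt_or_ge s 0 with hs | hs
    · simp [m, f, hs]
    · simp [m, f, hs, visitMoment, lintegral_expLocalTime hX.measurableSet hX.right_continuous μ hκ]
  have hrenewal : m = f + k ⋆ₗ m := by
    rw [hm]
    exact add_lconvolution_eq_of_resolvent hf hk hw hres
  have hmt := congrFun hrenewal t
  rw [Pi.add_apply, lconvolution_indicator_Ici] at hmt
  simpa only [m, f, indicator_of_mem (mem_Ici.2 ht), Pi.one_apply] using hmt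

theorem isRenewalSolution (hX : IsRegenerativeState μ X i) (hκ : 0 ≤ κ) :
    IsRenewalSolution (fun t => μ.real (visit X i t)) κ
      fun t => ProbabilityTheory.mgf (localTime X i t.toNNReal) μ κ where
  measurable := by
    have := hX.isProbabilityMeasure
    exact (((measurable_uncurry_localTime hX.measurableSet hX.right_continuous).const_mul
      κ).exp.stronglyMeasurable.integral_prod_right').measurable
  bddAbove t := by
    have := hX.isProbabilityMeasure
    refine ⟨Real.exp (κ * t), ?_⟩
    rintro _ ⟨s, hs, rfl⟩
    have hle : ∀ ω, Real.exp (κ * localTime X i s.toNNReal ω) ≤ Real.exp (κ * t) := fun ω => by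
      have hlocalTime := localTime_le (hX.right_continuous ω) s.toNNReal
      rw [Real.coe_toNNReal s hs.1] at hlocalTime
      gcongr
      exact hlocalTime.trans hs.2
    simpa using! integral_mono (integrable_exp_mul_localTime hX.measurableSet
      hX.right_continuous μ κ _) (integrable_const _) hle
  renewal t ht := by
    have := hX.isProbabilityMeasure
    simp only [hX.ofReal_mgf_localTime, ENNReal.ofReal_mul hκ,
      ofReal_measureReal (measure_ne_top μ _)]
    exact hX.lintegral_expLocalTime_eq hκ ht

theorem tendsto_one_div_mul_cgf (hX : IsRegenerativeState μ X i) (hκ : 0 < κ) :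
    Tendsto (fun t : ℝ≥0 => (1 / (t : ℝ)) * ProbabilityTheory.cgf (localTime X i t) μ κ) atTop
      (𝓝 (rate (fun t => μ.real (visit X i t)) κ)) := by
  simpa only [Function.comp_def, Real.toNNReal_coe] using!
    ((hX.isRenewalSolution hκ.le).tendsto_one_div_mul_log hX.isReturnFunction hκ).comp
      (NNReal.tendsto_coe_atTop.2 tendsto_id)

theorem convexOn_cgf_localTime (hX : IsRegenerativeState μ X i) (t : ℝ≥0) :
    ConvexOn ℝ univ (ProbabilityTheory.cgf (localTime X i t) μ) := by
  have := hX.isProbabilityMeasure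
  have hset : ProbabilityTheory.integrableExpSet (localTime X i t) μ = univ :=
    eq_univ_of_forall fun κ =>
      integrable_exp_mul_localTime hX.measurableSet hX.right_continuous μ κ t
  simpa only [hset, interior_univ] using convexOn_cgf (X := localTime X i t) (μ := μ)

theorem convexOn_rate (hX : IsRegenerativeState μ X i) :
    ConvexOn ℝ (Ioi 0) (rate fun t => μ.real (visit X i t)) := by
  refine ⟨convex_Ioi 0, fun x (hx : 0 < x) y (hy : 0 < y) u v hu hv huv => ?_⟩
  refine le_of_tendsto_of_tendsto'
    (hX.tendsto_one_div_mul_cgf (convex_Ioi (0 : ℝ) hx hy hu hv huv))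
    (((hX.tendsto_one_div_mul_cgf hx).const_smul u).add
      ((hX.tendsto_one_div_mul_cgf hy).const_smul v)) fun t => ?_
  exact (((hX.convexOn_cgf_localTime t).smul (by positivity : 0 ≤ 1 / (t : ℝ))).2
    (mem_univ x) (mem_univ y) hu hv huv)

end IsRegenerativeState

end RegenerativeState

theorem tendsto_mul_rpow_of_isEquivalent {f : ℝ≥0 → ℝ} {c α : ℝ} (hc : c ≠ 0)
    (h : f ~[atTop] fun t : ℝ≥0 => c * (t : ℝ) ^ (-α)) :
    Tendsto (fun t : ℝ => f t.toNNReal * t ^ α) atTop (𝓝 c) := by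
  have hne : ∀ᶠ t : ℝ≥0 in atTop, c * (t : ℝ) ^ (-α) ≠ 0 := by
    filter_upwards [eventually_gt_atTop 0] with t ht
    exact mul_ne_zero hc (Real.rpow_pos_of_pos (NNReal.coe_pos.2 ht) _).ne'
  have hratio := (((isEquivalent_iff_tendsto_one hne).1 h).comp
    tendsto_real_toNNReal_atTop).mul_const c
  rw [one_mul] at hratio
  refine hratio.congr' ?_
  filter_upwards [eventually_gt_atTop 0] with t ht
  have hpow := (Real.rpow_pos_of_pos ht α).ne'
  simp only [Function.comp, Pi.div_apply, Real.coe_toNNReal t ht.le, Real.rpow_neg ht.le]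
  field_simp

end

end LocalTimeRate

open LocalTimeRate in
theorem mainTheorem7_general {S Ω : Type*} [MeasurableSpace Ω] (P : S → Measure Ω)
    (X : ℝ≥0 → Ω → S) (i : S) (hX : IsRegenerativeState (P i) X i) :
    ∃ r : ℝ → ℝ,
      (∀ κ : ℝ, 0 < κ →
        Tendsto (fun t : ℝ≥0 => (1 / (t : ℝ)) * Real.log (expMoment P X i κ t)) atTop
          (𝓝 (r κ))) ∧
      (∀ κ : ℝ, 0 < κ → 0 ≤ r κ ∧ (0 < r κ ↔ kappaCr P X i < κ)) ∧
      (∀ κ : ℝ, 0 < κ → r κ ≤ κ) ∧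
      Tendsto (fun κ : ℝ => r κ / κ) atTop (𝓝 1) ∧
      ∀ c α : ℝ, 0 < c → 0 < α →
        (fun t : ℝ≥0 => transProb P X t i i) ~[atTop] (fun t : ℝ≥0 => c * (t : ℝ) ^ (-α)) →
        StrictConvexOn ℝ (Set.Ioi (kappaCr P X i)) r ∧
        (α ≤ 1 → kappaCr P X i = 0) ∧
        (α < 1 →
          r ~[𝓝[>] 0] fun κ : ℝ =>
            κ ^ (1 / (1 - α)) * (c * Real.Gamma (1 - α)) ^ (1 / (1 - α))) ∧
        (α = 1 →
          ∃ ε : ℝ → ℝ, ε =o[𝓝[>] 0] (fun κ : ℝ => κ⁻¹) ∧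
            r ~[𝓝[>] 0] fun κ : ℝ => Real.exp (-(c * κ)⁻¹ + ε κ)) ∧
        (1 < α → green P X i ≠ ⊤ ∧ 0 < kappaCr P X i) ∧
        (1 < α → α < 2 →
          r ~[𝓝[>] (kappaCr P X i)] fun κ : ℝ =>
            (κ - kappaCr P X i) ^ (1 / (α - 1)) *
              ((green P X i).toReal ^ 2 * (α - 1) / (c * Real.Gamma (2 - α))) ^ (1 / (α - 1))) ∧
        (α = 2 →
          r ~[𝓝[>] (kappaCr P X i)] fun κ : ℝ =>
            (κ - kappaCr P X i) / Real.log (1 / (κ - kappaCr P X i)) *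
              ((green P X i).toReal ^ 2 / c)) ∧
        (2 < α →
          greenMoment P X i ≠ ⊤ ∧
          r ~[𝓝[>] (kappaCr P X i)] fun κ : ℝ =>
            (κ - kappaCr P X i) *
              ((green P X i).toReal ^ 2 / (greenMoment P X i).toReal)) := by
  have hp := hX.isReturnFunction
  refine ⟨rate fun t => transProb P X t.toNNReal i i, fun κ hκ => hX.tendsto_one_div_mul_cgf hκ,
    fun κ hκ => ⟨rate_nonneg _ κ, hp.rate_pos_iff hκ⟩, fun κ hκ => hp.rate_le hκ,
    hp.tendsto_rate_div_atTop, fun c α hc hα hequiv => ?_⟩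
  have htail := tendsto_mul_rpow_of_isEquivalent hc.ne' hequiv
  refine ⟨hp.strictConvexOn_rate hα hc htail
      (hX.convexOn_rate.subset (Set.Ioi_subset_Ioi ENNReal.toReal_nonneg) (convex_Ioi _)),
    fun h => criticalValue_eq_zero (hp.mass_eq_top hc htail h),
    fun h => hp.isEquivalent_rate_of_lt_one hc htail hα.le h, ?_,
    fun h => ⟨hp.mass_ne_top htail h, hp.criticalValue_pos (hp.mass_ne_top htail h)⟩,
    fun h₁ h₂ => hp.isEquivalent_rate_of_lt_two hc htail h₁ h₂, ?_,
    fun h => ⟨hp.lintegral_mul_ne_top htail h, hp.isEquivalent_rate_of_two_lt htail h⟩⟩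
  · rintro rfl
    exact hp.isEquivalent_rate_of_eq_one hc htail
  · rintro rfl
    exact hp.isEquivalent_rate_of_eq_two hc htail

open LocalTimeRate in
theorem mainTheorem7 {S Ω : Type*} [Countable S] [MeasurableSpace S] [MeasurableSingletonClass S]
    [MeasurableSpace Ω] (a : S → S → ℝ) (P : S → Measure Ω) (X : ℝ≥0 → Ω → S)
    (hX : IsMarkovProcess a P X) (i : S) :
    ∃ r : ℝ → ℝ,
      (∀ κ : ℝ, 0 < κ →
        Tendsto (fun t : ℝ≥0 => (1 / (t : ℝ)) * Real.log (expMoment P X i κ t)) atTop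
          (𝓝 (r κ))) ∧
      (∀ κ : ℝ, 0 < κ → 0 ≤ r κ ∧ (0 < r κ ↔ kappaCr P X i < κ)) ∧
      (∀ κ : ℝ, 0 < κ → r κ ≤ κ) ∧
      Tendsto (fun κ : ℝ => r κ / κ) atTop (𝓝 1) ∧
      ∀ c α : ℝ, 0 < c → 0 < α →
        (fun t : ℝ≥0 => transProb P X t i i) ~[atTop] (fun t : ℝ≥0 => c * (t : ℝ) ^ (-α)) →
        StrictConvexOn ℝ (Set.Ioi (kappaCr P X i)) r ∧
        (α ≤ 1 → kappaCr P X i = 0) ∧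
        (α < 1 →
          r ~[𝓝[>] 0] fun κ : ℝ =>
            κ ^ (1 / (1 - α)) * (c * Real.Gamma (1 - α)) ^ (1 / (1 - α))) ∧
        (α = 1 →
          ∃ ε : ℝ → ℝ, ε =o[𝓝[>] 0] (fun κ : ℝ => κ⁻¹) ∧
            r ~[𝓝[>] 0] fun κ : ℝ => Real.exp (-(c * κ)⁻¹ + ε κ)) ∧
        (1 < α → green P X i ≠ ⊤ ∧ 0 < kappaCr P X i) ∧
        (1 < α → α < 2 →
          r ~[𝓝[>] (kappaCr P X i)] fun κ : ℝ =>
            (κ - kappaCr P X i) ^ (1 / (α - 1)) *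
              ((green P X i).toReal ^ 2 * (α - 1) / (c * Real.Gamma (2 - α))) ^ (1 / (α - 1))) ∧
        (α = 2 →
          r ~[𝓝[>] (kappaCr P X i)] fun κ : ℝ =>
            (κ - kappaCr P X i) / Real.log (1 / (κ - kappaCr P X i)) *
              ((green P X i).toReal ^ 2 / c)) ∧
        (2 < α →
          greenMoment P X i ≠ ⊤ ∧
          r ~[𝓝[>] (kappaCr P X i)] fun κ : ℝ =>
            (κ - kappaCr P X i) *
              ((green P X i).toReal ^ 2 / (greenMoment P X i).toReal)) :=
  mainTheorem7_general P X i (hX.isRegenerativeState i)
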